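/- Let $b,b^\dagger$ denote the bosonic annihilation and creation operators of a single bosonic mode (label $\beta$, Fock states $|n\rangle_\beta$, $n\ge 0$), and consider this mode together with a register ($q$-register) of $N$ qubits, with Hilbert space $\ell^2(\mathbb N)\otimes(\mathbb C^2)^{\otimes N}$. Let $O=|0\rangle\langle 0|\otimes I$ be the projection onto the state $|0\rangle$ of the first qubit of the $q$-register. There are absolute constants $c>0$ and $k\in\mathbb N$ such that the following holds. For all integers $N\ge 1$ and $T$ with $\sqrt N\le T\le 2^{N/2}$ there is a unitary $U$ on the bosonic mode and the $N$ qubits that preserves the boson number (that is, $U$ commutes with $|n\rangle\langle n|_\beta\otimes I$ for every $n$), such that the Hamiltonian $$H = U b + b^\dagger U^\dagger$$ generates a unitary time evolution $e^{-itH}$, $t\in\mathbb R$ (the strongly continuous one-parameter unitary group whose generator is $-i$ times the closure of $H$ on its natural domain), and such that every quantum circuit $W$ satisfying the following condition uses many two-qubit gates. Here $W$ acts on the $q$-register and an ancilla register of arbitrarily many qubits, and consists of arbitrary unitary one-qubit gates and arbitrary unitary two-qubit gates on arbitrary pairs of qubits. If $$\Big|\langle 0|_\beta\langle\phi|_q\,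 e^{iTH}(I_\beta\otimes O)e^{-iTH}\,|0\rangle_\beta|\phi\rangle_q-\langle 0|_{\mathrm{anc}}\langle\phi|_q\, W^\dagger(I_{\mathrm{anc}}\otimes O)W\,|0\rangle_{\mathrm{anc}}|\phi\rangle_q\Big|\le 0.1$$ for all unit vectors $|\phi\rangle_q\in(\mathbb C^2)^{\otimes N}$, where $|0\rangle_{\mathrm{anc}}$ is the state in which all ancilla qubits are $|0\rangle$, then the number of two-qubit gates in $W$ is at least $$c\,\frac{NT^2}{\log^k(NT^2+2)},$$ i.e. it is $\widetilde\Omega(NT^2)$. -/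

import Mathlib

noncomputable section

/-! ### Qubit registers -/

/-- The state space `(ℂ²)^{⊗ι}` of a register of qubits labelled by `ι`: the amplitude of the
computational basis state `|x⟩`, `x : ι → {0,1}`, in the state `φ` is `φ x`. -/
abbrev QReg (ι : Type) [Fintype ι] [DecidableEq ι] : Type := EuclideanSpace ℂ (ι → Fin 2)

/-- The projection `|0⟩⟨0|` on qubit `i`, tensored with the identity on all other qubits. -/
def zeroProj {ι : Type} [Fintype ι] [DecidableEq ι] (i : ι) : QReg ι →L[ℂ] QReg ι :=
  LinearMap.toContinuousLinearMap
    { toFun := fun φ => WithLp.toLp 2 (fun x => if x i = 0 then φ x else 0)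
      map_add' := by
        intro φ χ
        ext x
        by_cases h : x i = 0 <;> simp [h]
      map_smul' := by
        intro c φ
        ext x
        by_cases h : x i = 0 <;> simp [h] }

/-- One- and two-qubit gates: an arbitrary unitary acting on an arbitrary qubit, or on an
arbitrary pair of distinct qubits, of the register `ι`. -/
inductive QGate (ι : Type) : Type
  | one (i : ι) (u : Matrix.unitaryGroup (Fin 2) ℂ) : QGate ι
  | two (i j : ι) (hij : i ≠ j) (u : Matrix.unitaryGroup (Fin 2 × Fin 2) ℂ) : QGate ι

namespace QGate

/-- The action of a gate on the whole register (identity on the qubits it does not touch). -/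
def apply {ι : Type} [Fintype ι] [DecidableEq ι] : QGate ι → (QReg ι →ₗ[ℂ] QReg ι)
  | one i u =>
    { toFun := fun φ => WithLp.toLp 2 (fun x =>
        ∑ a : Fin 2, (u : Matrix (Fin 2) (Fin 2) ℂ) (x i) a * φ (Function.update x i a))
      map_add' := by
        intro φ χ
        ext x
        simp [mul_add, Finset.sum_add_distrib]
      map_smul' := by
        intro c φ
        ext x
        simp only [PiLp.smul_apply, smul_eq_mul, RingHom.id_apply, Finset.mul_sum]
        exact Finset.sum_congr rfl fun a _ => by ring }
  | two i j _ u =>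
    { toFun := fun φ => WithLp.toLp 2 (fun x =>
        ∑ p : Fin 2 × Fin 2,
          (u : Matrix (Fin 2 × Fin 2) (Fin 2 × Fin 2) ℂ) (x i, x j) p
            * φ (Function.update (Function.update x i p.1) j p.2))
      map_add' := by
        intro φ χ
        ext x
        simp only [PiLp.add_apply, mul_add, Finset.sum_add_distrib]
      map_smul' := by
        intro c φ
        ext x
        simp only [PiLp.smul_apply, smul_eq_mul, RingHom.id_apply, Finset.mul_sum]
        exact Finset.sum_congr rfl fun a _ => by ring }

/-- Whether a gate is a two-qubit gate. -/
def isTwo {ι : Type} : QGate ι → Bool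
  | one _ _ => false
  | two _ _ _ _ => true

end QGate

/-- A quantum circuit on the register `ι`: a finite sequence of one- and two-qubit gates, the
head of the list being applied first. -/
abbrev QCircuit (ι : Type) : Type := List (QGate ι)

namespace QCircuit

/-- The operator implemented by a circuit. -/
def apply {ι : Type} [Fintype ι] [DecidableEq ι] : QCircuit ι → (QReg ι →ₗ[ℂ] QReg ι)
  | [] => LinearMap.id
  | g :: W => (apply W).comp g.apply

/-- The number of two-qubit gates of a circuit. -/
def twoQubitGates {ι : Type} (W : QCircuit ι) : ℕ := W.countP QGate.isTwo

end QCircuit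

/-- The state `|0⟩_anc |φ⟩_q` of `a` ancilla qubits and `N` register qubits. -/
def withAncilla (a : ℕ) {N : ℕ} (φ : QReg (Fin N)) : QReg (Fin a ⊕ Fin N) :=
  WithLp.toLp 2 (fun x => if ∀ k : Fin a, x (Sum.inl k) = 0 then φ (fun j => x (Sum.inr j)) else 0)

/-! ### One bosonic mode coupled to `N` qubits -/

/-- The Hilbert space of one bosonic mode and `N` qubits, `ℓ²(ℕ) ⊗ (ℂ²)^{⊗N} ≃ ℓ²(ℕ; (ℂ²)^{⊗N})`:
the state `∑ n, |n⟩ ⊗ ψ n` is the sequence `ψ`. -/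
abbrev BosonQubit (N : ℕ) : Type := lp (fun _ : ℕ => QReg (Fin N)) 2

/-- The state `|n⟩_β |φ⟩_q`. -/
def fockState {N : ℕ} (n : ℕ) (φ : QReg (Fin N)) : BosonQubit N := lp.single 2 n φ

/-- The operator `I_β ⊗ A` on the coupled system. -/
def idTensor {N : ℕ} (A : QReg (Fin N) →L[ℂ] QReg (Fin N)) : BosonQubit N →L[ℂ] BosonQubit N :=
  lp.mapCLM 2 (fun _ => A) (norm_nonneg A) (fun _ => le_rfl)

/-- The unitary `U` preserves the bosonic number: it commutes with `|n⟩⟨n| ⊗ I` for every `n`. -/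
def NumberPreserving {N : ℕ} (U : BosonQubit N ≃ₗᵢ[ℂ] BosonQubit N) : Prop :=
  ∀ (n : ℕ) (ψ : BosonQubit N), U (fockState n (ψ n)) = fockState n (U ψ n)

/-- The domain of `b` and `b†`: the states `ψ` with `∑ n, n ‖ψ n‖² < ∞`. -/
def bosonDomain (N : ℕ) : Submodule ℂ (BosonQubit N) where
  carrier := {ψ | Memℓp (fun n : ℕ => ((Real.sqrt n : ℝ) : ℂ) • ψ n) 2}
  zero_mem' := by
    have h : (fun n : ℕ => ((Real.sqrt n : ℝ) : ℂ) • (0 : BosonQubit N) n) = 0 := by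
      ext n; simp
    show Memℓp _ 2
    rw [h]
    exact zero_memℓp
  add_mem' := by
    intro ψ χ hψ hχ
    have h := Memℓp.add hψ hχ
    have e : (fun n : ℕ => ((Real.sqrt n : ℝ) : ℂ) • (ψ + χ : BosonQubit N) n) =
        (fun n : ℕ => ((Real.sqrt n : ℝ) : ℂ) • ψ n) + fun n : ℕ => ((Real.sqrt n : ℝ) : ℂ) • χ n := by
      funext n
      exact smul_add _ _ _
    show Memℓp _ 2
    rw [e]
    exact h
  smul_mem' := by
    intro c ψ hψ
    have h := Memℓp.const_smul hψ c
    have e : (fun n : ℕ => ((Real.sqrt n : ℝ) : ℂ) • (c • ψ : BosonQubit N) n) =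
        c • fun n : ℕ => ((Real.sqrt n : ℝ) : ℂ) • ψ n := by
      funext n
      exact smul_comm _ c _
    show Memℓp _ 2
    rw [e]
    exact h

theorem memℓp_lower {N : ℕ} {ψ : BosonQubit N} (hψ : ψ ∈ bosonDomain N) :
    Memℓp (fun n : ℕ => ((Real.sqrt (n + 1) : ℝ) : ℂ) • ψ (n + 1)) 2 := by
  have h := (memℓp_gen_iff (p := 2) (by norm_num)).1 hψ
  refine (memℓp_gen_iff (p := 2) (by norm_num)).2 ?_
  simpa using (summable_nat_add_iff 1).2 h

/-- The values of `b†ψ`: `(b†ψ)₀ = 0` and `(b†ψ)ₙ₊₁ = √(n+1) ψₙ`. -/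
def raiseFun {E : Type} [AddCommGroup E] [Module ℂ E] (ψ : ℕ → E) : ℕ → E
  | 0 => 0
  | n + 1 => ((Real.sqrt (n + 1) : ℝ) : ℂ) • ψ n

theorem memℓp_raise {N : ℕ} {ψ : BosonQubit N} (hψ : ψ ∈ bosonDomain N) :
    Memℓp (raiseFun (fun n : ℕ => ψ n)) 2 := by
  have h := (memℓp_gen_iff (p := 2) (by norm_num)).1 hψ
  have h' := (memℓp_gen_iff (p := 2) (by norm_num)).1 (lp.memℓp ψ)
  refine (memℓp_gen_iff (p := 2) (by norm_num)).2 ?_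
  refine (summable_nat_add_iff 1).1 ?_
  refine (h.add h').congr fun n => ?_
  have h1 : (0 : ℝ) ≤ n := n.cast_nonneg
  have h2 : (0 : ℝ) ≤ (n : ℝ) + 1 := by positivity
  simp only [raiseFun, norm_smul, Complex.norm_real, Real.norm_eq_abs, ENNReal.toReal_ofNat,
    Real.rpow_two, mul_pow, sq_abs, Real.sq_sqrt h1, Real.sq_sqrt h2]
  ring

/-- The bosonic annihilation operator `b` (tensored with the identity on the qubits):
`b |n⟩ = √n |n-1⟩`. -/
def annihilation (N : ℕ) : BosonQubit N →ₗ.[ℂ] BosonQubit N where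
  domain := bosonDomain N
  toFun :=
    { toFun := fun ψ => ⟨fun n : ℕ => ((Real.sqrt (n + 1) : ℝ) : ℂ) • (ψ : BosonQubit N) (n + 1),
        memℓp_lower ψ.2⟩
      map_add' := by
        intro ψ χ
        apply lp.ext
        funext n
        exact smul_add _ _ _
      map_smul' := by
        intro c ψ
        apply lp.ext
        funext n
        exact smul_comm _ c _ }

/-- The bosonic creation operator `b†` (tensored with the identity on the qubits):
`b† |n⟩ = √(n+1) |n+1⟩`. -/
def creation (N : ℕ) : BosonQubit N →ₗ.[ℂ] BosonQubit N where
  domain := bosonDomain N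
  toFun :=
    { toFun := fun ψ => ⟨raiseFun (fun n : ℕ => (ψ : BosonQubit N) n), memℓp_raise ψ.2⟩
      map_add' := by
        intro ψ χ
        apply lp.ext
        funext n
        cases n with
        | zero => exact (add_zero (0 : QReg (Fin N))).symm
        | succ n => exact smul_add _ _ _
      map_smul' := by
        intro c ψ
        apply lp.ext
        funext n
        cases n with
        | zero => exact (smul_zero c).symm
        | succ n => exact smul_comm _ c _ }

/-- The composition `A B` of an unbounded operator `A` with an everywhere defined operator `B`,
on its natural domain `{ψ | B ψ ∈ dom A}`. -/
def LinearPMap.precomp {E : Type} [AddCommGroup E] [Module ℂ E]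
    (A : E →ₗ.[ℂ] E) (B : E →ₗ[ℂ] E) : E →ₗ.[ℂ] E where
  domain := A.domain.comap B
  toFun := A.toFun.comp (B.restrict (p := A.domain.comap B) (q := A.domain) fun _ h => h)

/-- The Hamiltonian `H = U b + b† U†`, as an unbounded operator on its natural domain. -/
def hamiltonian {N : ℕ} (U : BosonQubit N ≃ₗᵢ[ℂ] BosonQubit N) :
    BosonQubit N →ₗ.[ℂ] BosonQubit N :=
  (U.toLinearEquiv : BosonQubit N →ₗ[ℂ] BosonQubit N).compPMap (annihilation N)
    + (creation N).precomp (U.symm.toLinearEquiv : BosonQubit N →ₗ[ℂ] BosonQubit N)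

/-- `V t = e^{-itH}` for all real `t`: `V` is the strongly continuous one-parameter unitary group
whose infinitesimal generator is `-i` times the closure of `H`. (By Stone's theorem such a `V`
exists exactly when `H` is essentially self-adjoint, and then it is unique.) -/
structure IsTimeEvolution {E : Type} [NormedAddCommGroup E] [InnerProductSpace ℂ E]
    (H : E →ₗ.[ℂ] E) (V : ℝ → (E ≃ₗᵢ[ℂ] E)) : Prop where
  map_add : ∀ (s t : ℝ) (ψ : E), V (s + t) ψ = V s (V t ψ)
  continuous : ∀ ψ : E, Continuous fun t : ℝ => V t ψ
  generator : ∀ ψ η : E, (ψ, η) ∈ H.graph.topologicalClosure ↔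
    HasDerivAt (fun t : ℝ => V t ψ) (-(Complex.I • η)) 0

end

/-! The hardness sits in the choice of U, not in long-time dynamics. Given unitaries D_0 = 1, D_1,
D_2, ... on the qubits, let U act on the n-boson sector as D_n D_{n+1}⁻¹. Then H is b + b†
conjugated by the operator acting as D_n on sector n, so the vacuum evolves as under b + b†, into a
coherent state with Poisson boson number of mean t², except that its n-boson component carries D_n
φ. Measuring I ⊗ O therefore gives a Poisson average of the outcome probabilities of the states D_n
φ (`exists_timeEvolution_poisson`).

For N ≥ 20 take D_n = F for every n ≥ 1, where F adds to the first qubit a Boolean function f of the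
other N - 1 qubits. The vacuum weight e^{-T²} is at most 0.1 because T² ≥ N, so on basis states the
evolution computes f up to a small error, and a simulating circuit determines f. There are
2^(2^(N-1)) functions f. On the other side, one-qubit gates can be absorbed into two-qubit gates, R
two-qubit gates touch at most 2R ancillas, and rounding matrix entries to precision of order 1/R
leaves at most ((2R + N)² (64R + 1)³²)^R classes of circuits (`card_le_of_distinguished`). Hence
some f needs at least R = ⌊2^(N-1)/(35N)⌋ two-qubit gates (`exists_timeEvolution_hard`). Since T² ≤
2^N, this dominates N T² up to a constant and two logarithms (`div_log_sq_le`).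

For N < 20 the quantity N T² is bounded and one gate is enough: if D_n flips the first qubit exactly
for odd n, the outcome is nearly unbiased for every input, whereas a circuit of one-qubit gates
gives 0 with certainty on a suitable input (`exists_timeEvolution_pos`).

The unitary group is obtained from entire vectors: the states with finitely many bosons form an
invariant core on which the exponential series converges (`isTimeEvolution_expUnitary`,
`closure_graph_hamiltonian`). -/

noncomputable section

/-! ### Unitary groups generated by symmetric operators with entire vectors -/

section EntireVectors

open Complex Filter Topology
open scoped Nat InnerProductSpace

variable {E : Type} [NormedAddCommGroup E] [InnerProductSpace ℂ E]

/-- Every vector of the domain of `A` is an entire vector: its exponential series converges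
absolutely at all times. -/
def HasEntireVectors {D : Submodule ℂ E} (A : D →ₗ[ℂ] D) : Prop :=
  ∀ (f : D) (r : ℝ), 0 ≤ r → Summable fun k : ℕ => r ^ k / (k ! : ℝ) * ‖((A ^ k) f : E)‖

/-- The `k`-th term of the series of `e^{-itA} f`. -/
def expTerm {D : Submodule ℂ E} (A : D →ₗ[ℂ] D) (t : ℝ) (f : D) (k : ℕ) : E :=
  ((-(I * t)) ^ k / (k ! : ℂ)) • ((A ^ k) f : E)

theorem norm_expTerm {D : Submodule ℂ E} (A : D →ₗ[ℂ] D) (t : ℝ) (f : D) (k : ℕ) :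
    ‖expTerm A t f k‖ = |t| ^ k / (k ! : ℝ) * ‖((A ^ k) f : E)‖ := by
  simp [expTerm, norm_smul]

variable [CompleteSpace E]

theorem summable_expTerm {D : Submodule ℂ E} {A : D →ₗ[ℂ] D} (hA : HasEntireVectors A)
    (t : ℝ) (f : D) : Summable (expTerm A t f) := by
  refine Summable.of_norm ?_
  simpa only [norm_expTerm] using hA f |t| (abs_nonneg t)

/-- The sum of the series of `e^{-itA} f`. -/
def expSum {D : Submodule ℂ E} {A : D →ₗ[ℂ] D} (hA : HasEntireVectors A) (t : ℝ) : D →ₗ[ℂ] E where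
  toFun f := ∑' k, expTerm A t f k
  map_add' f g := by
    rw [← (summable_expTerm hA t f).tsum_add (summable_expTerm hA t g)]
    congr 1; funext k
    simp [expTerm, smul_add]
  map_smul' c f := by
    rw [RingHom.id_apply, ← (summable_expTerm hA t f).tsum_const_smul c]
    congr 1; funext k
    simp only [expTerm, map_smul, Submodule.coe_smul]
    exact smul_comm _ _ _

theorem hasSum_expSum {D : Submodule ℂ E} {A : D →ₗ[ℂ] D} (hA : HasEntireVectors A) (t : ℝ)
    (f : D) : HasSum (expTerm A t f) (expSum hA t f) :=
  (summable_expTerm hA t f).hasSum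

theorem expSum_zero {D : Submodule ℂ E} {A : D →ₗ[ℂ] D} (hA : HasEntireVectors A) (f : D) :
    expSum hA 0 f = f := by
  refine (hasSum_expSum hA 0 f).unique ?_
  convert hasSum_single (f := expTerm A 0 f) 0 ?_ using 1
  · simp [expTerm]
  · intro k hk
    simp [expTerm, hk]

/-- Differentiating term k + 1 for `f` gives -i times term k for `A f`. On a ball containing `t`
these derivatives are dominated by the absolutely convergent series of `A f`, so termwise
differentiation is allowed. -/
theorem hasDerivAt_expSum {D : Submodule ℂ E} {A : D →ₗ[ℂ] D} (hA : HasEntireVectors A) (f : D)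
    (t : ℝ) : HasDerivAt (fun t => expSum hA t f) (-(I • expSum hA t (A f))) t := by
  set r : ℝ := |t| + 1
  have hr : 0 ≤ r := by positivity
  let g' : ℕ → ℝ → E := fun k s => match k with
    | 0 => 0
    | k + 1 => -(I • expTerm A s (A f) k)
  let u : ℕ → ℝ := fun k => match k with
    | 0 => 0
    | k + 1 => r ^ k / (k ! : ℝ) * ‖((A ^ k) (A f) : E)‖
  have hu : Summable u := (summable_nat_add_iff 1).1 (hA (A f) r hr)
  have hg : ∀ n s, s ∈ Metric.ball (0 : ℝ) r → HasDerivAt (fun s => expTerm A s f n) (g' n s) s := by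
    intro n s _
    cases n with
    | zero => simpa [expTerm, g'] using hasDerivAt_const s (f : E)
    | succ k =>
      have h1 : HasDerivAt (fun s : ℝ => (-(I * (s : ℂ)))) (-(I * 1)) s :=
        ((HasDerivAt.ofReal_comp (hasDerivAt_id s)).const_mul I).neg
      have h2 := ((h1.pow (k + 1)).div_const ((k + 1)! : ℂ)).smul_const ((A ^ (k + 1)) f : E)
      refine h2.congr_deriv ?_
      have h3 : (k ! : ℂ) ≠ 0 := by exact_mod_cast k.factorial_ne_zero
      have h4 : (k + 1 : ℂ) ≠ 0 := by exact_mod_cast k.succ_ne_zero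
      simp only [g', expTerm, pow_succ A, Module.End.mul_apply, smul_smul, ← neg_smul]
      congr 1
      rw [Nat.factorial_succ]
      push_cast
      field_simp
  have hb : ∀ n s, s ∈ Metric.ball (0 : ℝ) r → ‖g' n s‖ ≤ u n := by
    intro n s hs
    cases n with
    | zero => simp [g', u]
    | succ k =>
      have hs' : |s| ≤ r := by
        rw [mem_ball_zero_iff] at hs
        exact hs.le
      simp only [g', u, norm_neg, norm_smul, norm_I, one_mul, norm_expTerm]
      gcongr
  have h := hasDerivAt_tsum_of_isPreconnected hu Metric.isOpen_ball
    (convex_ball (0 : ℝ) r).isPreconnected hg hb (y₀ := 0)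
    (Metric.mem_ball_self (by positivity)) (summable_expTerm hA 0 f) (y := t) (by simp [r])
  refine h.congr_deriv ?_
  have hs : Summable (fun n => g' n t) :=
    Summable.of_norm_bounded hu fun n => hb n t (by simp [r])
  rw [hs.tsum_eq_zero_add]
  simp only [g', zero_add]
  rw [tsum_neg, (summable_expTerm hA t (A f)).tsum_const_smul]
  rfl

/-- The vectors `expSum hA s f` may leave `D`, so `A` cannot be applied to them directly. Symmetry
is used on each term, expanding one series at a time. -/
theorem inner_expSum_apply {D : Submodule ℂ E} {A : D →ₗ[ℂ] D} (hA : HasEntireVectors A)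
    (hsym : ∀ f g : D, ⟪(A f : E), (g : E)⟫_ℂ = ⟪(f : E), (A g : E)⟫_ℂ) (s t : ℝ) (f g : D) :
    ⟪expSum hA s f, expSum hA t (A g)⟫_ℂ = ⟪expSum hA s (A f), expSum hA t g⟫_ℂ := by
  have key : ∀ x : D, ⟪(x : E), expSum hA t (A g)⟫_ℂ = ⟪(A x : E), expSum hA t g⟫_ℂ := by
    intro x
    have h1 := (hasSum_expSum hA t (A g)).mapL (innerSL ℂ (x : E))
    have h2 := (hasSum_expSum hA t g).mapL (innerSL ℂ (A x : E))
    refine h1.unique (h2.congr_fun fun k => ?_)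
    simp only [expTerm, innerSL_apply_apply, inner_smul_right]
    congr 1
    rw [hsym]
    congr 2
    rw [← Module.End.mul_apply, ← Module.End.mul_apply, ← pow_succ', pow_succ]
  have h1 := (hasSum_expSum hA s f).mapL (innerSLFlip ℂ (expSum hA t (A g)))
  have h2 := (hasSum_expSum hA s (A f)).mapL (innerSLFlip ℂ (expSum hA t g))
  refine h1.unique (h2.congr_fun fun k => ?_)
  simp only [expTerm, innerSLFlip_apply_apply, inner_smul_left]
  rw [key]
  congr 3
  rw [← Module.End.mul_apply, ← Module.End.mul_apply, ← pow_succ', pow_succ]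

/-- The derivative in `s` vanishes by symmetry, so the value at s = 0 persists. The case t = 0 gives
isometry; general `t` gives the group law. -/
theorem inner_expSum_add {D : Submodule ℂ E} {A : D →ₗ[ℂ] D} (hA : HasEntireVectors A)
    (hsym : ∀ f g : D, ⟪(A f : E), (g : E)⟫_ℂ = ⟪(f : E), (A g : E)⟫_ℂ) (s t : ℝ) (f g : D) :
    ⟪expSum hA s f, expSum hA (s + t) g⟫_ℂ = ⟪(f : E), expSum hA t g⟫_ℂ := by
  have h : ∀ s : ℝ, HasDerivAt (fun s => ⟪expSum hA s f, expSum hA (s + t) g⟫_ℂ) 0 s := by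
    intro s
    have h1 := hasDerivAt_expSum hA f s
    have h2 := (hasDerivAt_expSum hA g (s + t)).comp_add_const s t
    refine (h1.inner ℂ h2).congr_deriv ?_
    rw [inner_neg_left, inner_neg_right, inner_smul_left, inner_smul_right,
      inner_expSum_apply hA hsym, conj_I]
    ring
  have h3 := is_const_of_deriv_eq_zero (fun s => (h s).differentiableAt) (fun s => (h s).deriv) s 0
  simpa only [zero_add, expSum_zero] using h3

theorem norm_expSum {D : Submodule ℂ E} {A : D →ₗ[ℂ] D} (hA : HasEntireVectors A)
    (hsym : ∀ f g : D, ⟪(A f : E), (g : E)⟫_ℂ = ⟪(f : E), (A g : E)⟫_ℂ) (t : ℝ) (f : D) :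
    ‖expSum hA t f‖ = ‖(f : E)‖ := by
  have h := inner_expSum_add hA hsym t 0 f f
  rw [add_zero, expSum_zero, inner_self_eq_norm_sq_to_K, inner_self_eq_norm_sq_to_K] at h
  have h' : ‖expSum hA t f‖ ^ 2 = ‖(f : E)‖ ^ 2 := by exact_mod_cast h
  exact (sq_eq_sq₀ (norm_nonneg _) (norm_nonneg _)).1 h'

/-- The bounded extension of `e^{-itA}` to the whole space. -/
def expExtend {D : Submodule ℂ E} {A : D →ₗ[ℂ] D} (hA : HasEntireVectors A) (t : ℝ) : E →L[ℂ] E :=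
  (expSum hA t).extendOfNorm D.subtype

/-! ### Extension to a unitary group on the whole space, and identification of its generator. -/

section Extend

variable {D : Submodule ℂ E} {A : D →ₗ[ℂ] D} (hA : HasEntireVectors A)
  (hsym : ∀ f g : D, ⟪(A f : E), (g : E)⟫_ℂ = ⟪(f : E), (A g : E)⟫_ℂ) (hD : Dense (D : Set E))

include hA hsym hD

theorem expExtend_coe (t : ℝ) (f : D) : expExtend hA t f = expSum hA t f :=
  LinearMap.extendOfNorm_eq (e := D.subtype) (by simpa [DenseRange] using hD)
    ⟨1, fun x => by simp [norm_expSum hA hsym]⟩ f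

theorem norm_expExtend (t : ℝ) (ψ : E) : ‖expExtend hA t ψ‖ = ‖ψ‖ :=
  hD.induction (P := fun ψ => ‖expExtend hA t ψ‖ = ‖ψ‖)
    (fun f hf => by
      have := norm_expSum hA hsym t ⟨f, hf⟩
      rwa [← expExtend_coe hA hsym hD] at this)
    (isClosed_eq (by fun_prop) (by fun_prop)) ψ

/-- The series cannot be composed because `expSum hA t f` may lie outside `D`. Instead, the two
sides have equal norms and their inner product is the square of that norm, so the norm of their
difference is zero. -/
theorem expExtend_expSum (s t : ℝ) (f : D) :
    expExtend hA s (expSum hA t f) = expSum hA (s + t) f := by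
  have h1 : ∀ ψ : E, ⟪expExtend hA s ψ, expSum hA (s + t) f⟫_ℂ = ⟪ψ, expSum hA t f⟫_ℂ := by
    refine hD.induction (fun g hg => ?_) (isClosed_eq (by fun_prop) (by fun_prop))
    rw [← inner_expSum_add hA hsym s t ⟨g, hg⟩ f, ← expExtend_coe hA hsym hD s]
  have h2 : ‖expExtend hA s (expSum hA t f) - expSum hA (s + t) f‖ ^ 2 = 0 := by
    rw [@norm_sub_sq ℂ, h1, inner_self_eq_norm_sq_to_K, norm_expExtend hA hsym hD,
      norm_expSum hA hsym, norm_expSum hA hsym]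
    norm_cast
    ring
  simpa [sub_eq_zero] using h2

theorem expExtend_add (s t : ℝ) (ψ : E) :
    expExtend hA (s + t) ψ = expExtend hA s (expExtend hA t ψ) :=
  hD.induction (P := fun ψ => expExtend hA (s + t) ψ = expExtend hA s (expExtend hA t ψ))
    (fun f hf => by
      rw [← expExtend_expSum hA hsym hD s t ⟨f, hf⟩ |>.trans
        (expExtend_coe hA hsym hD (s + t) ⟨f, hf⟩).symm, ← expExtend_coe hA hsym hD])
    (isClosed_eq (by fun_prop) (by fun_prop)) ψ

theorem expExtend_zero (ψ : E) : expExtend hA 0 ψ = ψ :=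
  hD.induction (P := fun ψ => expExtend hA 0 ψ = ψ)
    (fun f hf => by
      exact (expExtend_coe hA hsym hD 0 ⟨f, hf⟩).trans (expSum_zero hA ⟨f, hf⟩))
    (isClosed_eq (by fun_prop) (by fun_prop)) ψ

/-- The unitary operator `e^{-itA}`. -/
def expUnitary (t : ℝ) : E ≃ₗᵢ[ℂ] E where
  toLinearEquiv :=
    { (expExtend hA t : E →ₗ[ℂ] E) with
      invFun := expExtend hA (-t)
      left_inv := fun ψ => by
        simp [← expExtend_add hA hsym hD, expExtend_zero hA hsym hD]
      right_inv := fun ψ => by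
        simp [← expExtend_add hA hsym hD, expExtend_zero hA hsym hD] }
  norm_map' := norm_expExtend hA hsym hD t

theorem continuous_expExtend (ψ : E) : Continuous fun t => expExtend hA t ψ := by
  refine hD.induction (P := fun ψ => Continuous fun t => expExtend hA t ψ) (fun f hf => ?_) ?_ ψ
  · have h : (fun t => expExtend hA t f) = fun t => expSum hA t ⟨f, hf⟩ :=
      funext fun t => expExtend_coe hA hsym hD t ⟨f, hf⟩
    rw [h]
    exact continuous_iff_continuousAt.2 fun t => (hasDerivAt_expSum hA ⟨f, hf⟩ t).continuousAt
  · rw [← isSeqClosed_iff_isClosed]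
    intro x y hx hy
    refine TendstoUniformly.continuous (F := fun n t => expExtend hA t (x n)) (p := atTop) ?_
      (Frequently.of_forall hx)
    rw [Metric.tendstoUniformly_iff]
    intro ε hε
    filter_upwards [(Metric.tendsto_nhds.1 hy) ε hε] with n hn t
    rwa [dist_eq_norm, ← map_sub, norm_expExtend hA hsym hD, ← dist_eq_norm, dist_comm]

/-- Along approximating vectors of `D` the derivatives of the orbits converge uniformly in time,
because the evolution is isometric; hence the limiting orbit is differentiable. -/
theorem hasDerivAt_of_mem_closure {ψ η : E}
    (h : (ψ, η) ∈ closure (Set.range fun f : D => ((f : E), (A f : E)))) :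
    HasDerivAt (fun t => expExtend hA t ψ) (-(I • η)) 0 := by
  obtain ⟨x, hx, hlim⟩ := mem_closure_iff_seq_limit.1 h
  choose f hf using hx
  have h1 : Tendsto (fun n => (f n : E)) atTop (𝓝 ψ) := by
    simpa [Function.comp_def, ← hf] using (continuous_fst.tendsto _).comp hlim
  have h2 : Tendsto (fun n => (A (f n) : E)) atTop (𝓝 η) := by
    simpa [Function.comp_def, ← hf] using (continuous_snd.tendsto _).comp hlim
  have key := hasDerivAt_of_tendstoUniformly (𝕜 := ℝ) (l := atTop)
    (f := fun n t => expExtend hA t (f n)) (f' := fun n t => -(I • expExtend hA t (A (f n))))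
    (g := fun t => expExtend hA t ψ) (g' := fun t => -(I • expExtend hA t η)) ?_ ?_ ?_ 0
  · simpa only [expExtend_zero hA hsym hD] using key
  · rw [Metric.tendstoUniformly_iff]
    intro ε hε
    filter_upwards [(Metric.tendsto_nhds.1 h2) ε hε] with n hn t
    rw [dist_neg_neg, dist_eq_norm, ← smul_sub, ← map_sub, norm_smul, norm_I, one_mul,
      norm_expExtend hA hsym hD, ← dist_eq_norm, dist_comm]
    exact hn
  · refine Eventually.of_forall fun n t => ?_
    simp only [expExtend_coe hA hsym hD]
    exact hasDerivAt_expSum hA (f n) t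
  · intro t
    exact ((expExtend hA t).continuous.tendsto ψ).comp h1

/-- The squared norm is constant along the orbit, but its derivative at 0 would be 2‖χ‖². -/
theorem eq_zero_of_hasDerivAt_self {χ : E} (h : HasDerivAt (fun t => expExtend hA t χ) χ 0) :
    χ = 0 := by
  have h1 := h.inner ℂ h
  simp only [expExtend_zero hA hsym hD, inner_self_eq_norm_sq_to_K,
    norm_expExtend hA hsym hD] at h1
  have h2 := h1.unique (hasDerivAt_const (0 : ℝ) _)
  have h3 : ‖χ‖ ^ 2 + ‖χ‖ ^ 2 = 0 := by
    refine Complex.ofReal_injective ?_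
    push_cast
    exact h2
  have h4 : ‖χ‖ = 0 := by nlinarith [norm_nonneg χ]
  simpa using h4

omit [CompleteSpace E] hA hD in
theorem norm_apply_sub_I_smul_sq (f : D) :
    ‖(A f : E) - I • (f : E)‖ ^ 2 = ‖(A f : E)‖ ^ 2 + ‖(f : E)‖ ^ 2 := by
  have him : (⟪(A f : E), (f : E)⟫_ℂ).im = 0 := by
    have h := hsym f f
    rw [← inner_conj_symm (f : E)] at h
    have := congrArg Complex.im h
    rw [conj_im] at this
    linarith
  rw [@norm_sub_sq ℂ, inner_smul_right, norm_smul, norm_I, one_mul]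
  simp [him]

/-- Orthogonality makes the inner product of ψ with e^{-itA} f equal to e^t ⟨ψ, f⟩. Isometry bounds
it uniformly in `t`, so it vanishes on the dense `D`. -/
theorem eq_zero_of_orthogonal_range {ψ : E}
    (h : ∀ f : D, ⟪ψ, (A f : E) - I • (f : E)⟫_ℂ = 0) : ψ = 0 := by
  have hpow : ∀ (k : ℕ) (f : D), ⟪ψ, ((A ^ k) f : E)⟫_ℂ = I ^ k * ⟪ψ, (f : E)⟫_ℂ := by
    intro k
    induction k with
    | zero => simp
    | succ k ih =>
      intro f
      have := h f
      rw [inner_sub_right, inner_smul_right, sub_eq_zero] at this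
      rw [pow_succ, Module.End.mul_apply, ih, this, pow_succ]
      ring
  refine hD.eq_zero_of_inner_left ℂ fun f hf => ?_
  have hexp : ∀ t : ℝ, ⟪ψ, expSum hA t ⟨f, hf⟩⟫_ℂ = Complex.exp t * ⟪ψ, f⟫_ℂ := by
    intro t
    have h1 := (hasSum_expSum hA t ⟨f, hf⟩).mapL (innerSL ℂ ψ)
    have h2 := (NormedSpace.expSeries_div_hasSum_exp (t : ℂ)).mul_right ⟪ψ, f⟫_ℂ
    rw [← Complex.exp_eq_exp_ℂ] at h2
    refine h1.unique (h2.congr_fun fun k => ?_)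
    simp only [expTerm, innerSL_apply_apply, inner_smul_right, hpow]
    have h3 : (-(I * (t : ℂ))) ^ k * I ^ k = (t : ℂ) ^ k := by
      rw [← mul_pow]
      congr 1
      linear_combination (-(t : ℂ)) * I_mul_I
    rw [← h3]
    ring
  by_contra hne
  have hbound : ∀ t : ℝ, Real.exp t ≤ ‖ψ‖ * ‖f‖ / ‖⟪ψ, f⟫_ℂ‖ := by
    intro t
    have h1 := norm_inner_le_norm (𝕜 := ℂ) ψ (expSum hA t ⟨f, hf⟩)
    rw [hexp, norm_expSum hA hsym, norm_mul, ← Complex.ofReal_exp, Complex.norm_real,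
      Real.norm_of_nonneg (Real.exp_pos t).le] at h1
    rw [le_div_iff₀ (norm_pos_iff.2 hne)]
    exact h1
  obtain ⟨t, ht⟩ := (Real.tendsto_exp_atTop.eventually_gt_atTop _).exists
  exact absurd (hbound t) (not_le.2 ht)

/-- The range of A - i is dense and A - i is bounded below, so the closure of A has a vector ψ'
solving (A - i)ψ' = η - iψ. Subtracting the two derivatives shows that ψ - ψ' has an orbit with
derivative ψ - ψ' at 0, hence ψ = ψ'. -/
theorem mem_closure_of_hasDerivAt {ψ η : E}
    (h : HasDerivAt (fun t => expExtend hA t ψ) (-(I • η)) 0) :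
    (ψ, η) ∈ closure (Set.range fun f : D => ((f : E), (A f : E))) := by
  let R : D →ₗ[ℂ] E := D.subtype ∘ₗ A - I • D.subtype
  have hR : ∀ f, R f = (A f : E) - I • (f : E) := fun f => rfl
  have hdense : Dense (LinearMap.range R : Set E) := by
    rw [Submodule.dense_iff_topologicalClosure_eq_top,
      Submodule.topologicalClosure_eq_top_iff, Submodule.eq_bot_iff]
    intro ψ hψ
    refine eq_zero_of_orthogonal_range hA hsym hD fun f => ?_
    exact inner_eq_zero_symm.1 (hψ _ ⟨f, rfl⟩)
  obtain ⟨x, hx, hlim⟩ := mem_closure_iff_seq_limit.1 (hdense (η - I • ψ))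
  choose f hf using hx
  have hle : ∀ g : D, ‖(g : E)‖ ≤ ‖R g‖ := by
    intro g
    refine (sq_le_sq₀ (norm_nonneg _) (norm_nonneg _)).1 ?_
    rw [hR, norm_apply_sub_I_smul_sq hsym]
    have := sq_nonneg ‖(A g : E)‖
    linarith
  have hcauchy : CauchySeq fun n => (f n : E) := by
    rw [Metric.cauchySeq_iff]
    intro ε hε
    obtain ⟨n, hn⟩ := Metric.cauchySeq_iff.1 hlim.cauchySeq ε hε
    refine ⟨n, fun a ha b hb => lt_of_le_of_lt ?_ (hn a ha b hb)⟩
    rw [dist_eq_norm, dist_eq_norm, ← hf, ← hf, ← map_sub]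
    exact hle (f a - f b)
  obtain ⟨ψ', hψ'⟩ := cauchySeq_tendsto_of_complete hcauchy
  have hη' : Tendsto (fun n => (A (f n) : E)) atTop (𝓝 (η - I • ψ + I • ψ')) := by
    refine (hlim.add (hψ'.const_smul I)).congr fun n => ?_
    rw [← hf, hR, sub_add_cancel]
  have hmem : (ψ', η - I • ψ + I • ψ') ∈
      closure (Set.range fun f : D => ((f : E), (A f : E))) :=
    mem_closure_of_tendsto (hψ'.prodMk_nhds hη') (Eventually.of_forall fun n => ⟨f n, rfl⟩)
  have hd := h.sub (hasDerivAt_of_mem_closure hA hsym hD hmem)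
  have hzero : ψ - ψ' = 0 := by
    refine eq_zero_of_hasDerivAt_self hA hsym hD ?_
    have : (fun t => expExtend hA t (ψ - ψ')) =
        (fun t => expExtend hA t ψ) - fun t => expExtend hA t ψ' := by
      funext t; simp
    rw [this]
    refine hd.congr_deriv ?_
    have h2 : ψ - ψ' = -((I * I) • (ψ - ψ')) := by rw [I_mul_I]; simp
    rw [h2, mul_smul]
    simp only [smul_add, smul_sub]
    abel
  rw [sub_eq_zero] at hzero
  rw [← hzero] at hmem
  simpa using hmem

theorem isTimeEvolution_expUnitary (H : E →ₗ.[ℂ] E)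
    (hH : closure (H.graph : Set (E × E)) = closure (Set.range fun f : D => ((f : E), (A f : E)))) :
    IsTimeEvolution H (expUnitary hA hsym hD) where
  map_add := expExtend_add hA hsym hD
  continuous := continuous_expExtend hA hsym hD
  generator ψ η := by
    rw [← SetLike.mem_coe, Submodule.topologicalClosure_coe, hH]
    exact ⟨hasDerivAt_of_mem_closure hA hsym hD, mem_closure_of_hasDerivAt hA hsym hD⟩

end Extend

end EntireVectors
end

noncomputable section

/-! ### Number-preserving dressings of the linear bosonic Hamiltonian -/

section Boson

open Complex Filter Topology
open scoped Nat InnerProductSpace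

variable {N : ℕ}

theorem hasSum_norm_sq (ψ : BosonQubit N) : HasSum (fun n => ‖ψ n‖ ^ 2) (‖ψ‖ ^ 2) := by
  simpa using lp.hasSum_norm (p := 2) (by norm_num) ψ

theorem memℓp_two_iff {f : ℕ → QReg (Fin N)} : Memℓp f 2 ↔ Summable fun n => ‖f n‖ ^ 2 := by
  simpa using memℓp_gen_iff (p := 2) (f := f) (by norm_num)

theorem memℓp_map (u : ℕ → QReg (Fin N) ≃ₗᵢ[ℂ] QReg (Fin N)) (ψ : BosonQubit N) :
    Memℓp (fun n => u n (ψ n)) 2 := by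
  rw [memℓp_two_iff]
  simpa using (hasSum_norm_sq ψ).summable

/-- The number-preserving unitary acting as `u n` on the sector with `n` bosons. -/
def sectorUnitary (u : ℕ → QReg (Fin N) ≃ₗᵢ[ℂ] QReg (Fin N)) : BosonQubit N ≃ₗᵢ[ℂ] BosonQubit N where
  toFun ψ := ⟨fun n => u n (ψ n), memℓp_map u ψ⟩
  invFun ψ := ⟨fun n => (u n).symm (ψ n), memℓp_map (fun n => (u n).symm) ψ⟩
  map_add' ψ χ := lp.ext (funext fun n => map_add (u n) (ψ n) (χ n))
  map_smul' c ψ := lp.ext (funext fun n => map_smul (u n) c (ψ n))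
  left_inv ψ := lp.ext (funext fun n => (u n).symm_apply_apply (ψ n))
  right_inv ψ := lp.ext (funext fun n => (u n).apply_symm_apply (ψ n))
  norm_map' ψ := by
    refine (sq_eq_sq₀ (norm_nonneg _) (norm_nonneg _)).1 ?_
    refine (hasSum_norm_sq _).unique ((hasSum_norm_sq ψ).congr_fun fun n => ?_)
    exact congrArg (· ^ 2) ((u n).norm_map (ψ n))

theorem sectorUnitary_apply (u : ℕ → QReg (Fin N) ≃ₗᵢ[ℂ] QReg (Fin N)) (ψ : BosonQubit N) (n : ℕ) :
    sectorUnitary u ψ n = u n (ψ n) := rfl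

theorem sectorUnitary_symm_apply (u : ℕ → QReg (Fin N) ≃ₗᵢ[ℂ] QReg (Fin N)) (ψ : BosonQubit N)
    (n : ℕ) : (sectorUnitary u).symm ψ n = (u n).symm (ψ n) := rfl

theorem numberPreserving_sectorUnitary (u : ℕ → QReg (Fin N) ≃ₗᵢ[ℂ] QReg (Fin N)) :
    NumberPreserving (sectorUnitary u) := by
  intro n ψ
  apply lp.ext
  funext k
  rw [sectorUnitary_apply]
  by_cases h : k = n
  · subst h
    simp [fockState, sectorUnitary_apply]
  · simp [fockState, h]

theorem mem_bosonDomain_iff {ψ : BosonQubit N} :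
    ψ ∈ bosonDomain N ↔ Summable fun n : ℕ => (n : ℝ) * ‖ψ n‖ ^ 2 := by
  change Memℓp _ 2 ↔ _
  rw [memℓp_two_iff]
  simp [norm_smul, mul_pow, abs_of_nonneg, Real.sqrt_nonneg]

theorem sectorUnitary_symm_mem {u : ℕ → QReg (Fin N) ≃ₗᵢ[ℂ] QReg (Fin N)} {ψ : BosonQubit N} :
    (sectorUnitary u).symm ψ ∈ bosonDomain N ↔ ψ ∈ bosonDomain N := by
  simp [mem_bosonDomain_iff, sectorUnitary_symm_apply]

theorem mem_domain_hamiltonian {u : ℕ → QReg (Fin N) ≃ₗᵢ[ℂ] QReg (Fin N)} {ψ : BosonQubit N} :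
    ψ ∈ (hamiltonian (sectorUnitary u)).domain ↔ ψ ∈ bosonDomain N := by
  change ψ ∈ bosonDomain N ⊓ (bosonDomain N).comap _ ↔ _
  rw [Submodule.mem_inf, Submodule.mem_comap]
  change ψ ∈ bosonDomain N ∧ (sectorUnitary u).symm ψ ∈ bosonDomain N ↔ _
  rw [sectorUnitary_symm_mem, and_self_iff]

theorem hamiltonian_apply (u : ℕ → QReg (Fin N) ≃ₗᵢ[ℂ] QReg (Fin N))
    (ψ : (hamiltonian (sectorUnitary u)).domain) :
    hamiltonian (sectorUnitary u) ψ =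
      sectorUnitary u (annihilation N ⟨ψ, mem_domain_hamiltonian.1 ψ.2⟩) +
      creation N ⟨(sectorUnitary u).symm ψ, sectorUnitary_symm_mem.2 (mem_domain_hamiltonian.1 ψ.2)⟩ :=
  rfl

theorem annihilation_apply (ψ : bosonDomain N) (n : ℕ) :
    annihilation N ψ n = ((Real.sqrt (n + 1) : ℝ) : ℂ) • (ψ : BosonQubit N) (n + 1) := rfl

theorem creation_apply_zero (ψ : bosonDomain N) : creation N ψ 0 = 0 := rfl

theorem creation_apply_succ (ψ : bosonDomain N) (n : ℕ) :
    creation N ψ (n + 1) = ((Real.sqrt (n + 1) : ℝ) : ℂ) • (ψ : BosonQubit N) n := rfl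

theorem inner_annihilation_coe (ψ χ : bosonDomain N) :
    ⟪annihilation N ψ, (χ : BosonQubit N)⟫_ℂ = ⟪(ψ : BosonQubit N), creation N χ⟫_ℂ := by
  have h1 := lp.hasSum_inner (𝕜 := ℂ) (annihilation N ψ) (χ : BosonQubit N)
  have h2 := lp.hasSum_inner (𝕜 := ℂ) (ψ : BosonQubit N) (creation N χ)
  rw [← hasSum_nat_add_iff' 1] at h2
  simp only [Finset.sum_range_one, creation_apply_zero, inner_zero_right, sub_zero,
    creation_apply_succ, inner_smul_right] at h2
  simp only [annihilation_apply, inner_smul_left, conj_ofReal] at h1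
  exact h1.unique h2

theorem inner_annihilation {ψ χ : BosonQubit N} (hψ : ψ ∈ bosonDomain N) (hχ : χ ∈ bosonDomain N) :
    ⟪annihilation N ⟨ψ, hψ⟩, χ⟫_ℂ = ⟪ψ, creation N ⟨χ, hχ⟩⟫_ℂ :=
  inner_annihilation_coe ⟨ψ, hψ⟩ ⟨χ, hχ⟩

theorem inner_hamiltonian (u : ℕ → QReg (Fin N) ≃ₗᵢ[ℂ] QReg (Fin N))
    (ψ χ : (hamiltonian (sectorUnitary u)).domain) :
    ⟪hamiltonian (sectorUnitary u) ψ, (χ : BosonQubit N)⟫_ℂ =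
      ⟪(ψ : BosonQubit N), hamiltonian (sectorUnitary u) χ⟫_ℂ := by
  have key (ψ χ : (hamiltonian (sectorUnitary u)).domain) :
      ⟪sectorUnitary u (annihilation N ⟨ψ, mem_domain_hamiltonian.1 ψ.2⟩), (χ : BosonQubit N)⟫_ℂ =
      ⟪(ψ : BosonQubit N), creation N ⟨(sectorUnitary u).symm χ,
        sectorUnitary_symm_mem.2 (mem_domain_hamiltonian.1 χ.2)⟩⟫_ℂ := by
    rw [LinearIsometryEquiv.inner_map_eq_flip]
    exact inner_annihilation _ _
  have key' (ψ χ : (hamiltonian (sectorUnitary u)).domain) :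
      ⟪creation N ⟨(sectorUnitary u).symm ψ,
        sectorUnitary_symm_mem.2 (mem_domain_hamiltonian.1 ψ.2)⟩, (χ : BosonQubit N)⟫_ℂ =
      ⟪(ψ : BosonQubit N), sectorUnitary u
        (annihilation N ⟨χ, mem_domain_hamiltonian.1 χ.2⟩)⟫_ℂ := by
    rw [← inner_conj_symm, ← key, inner_conj_symm]
  have h1 := congrArg (fun x => ⟪x, (χ : BosonQubit N)⟫_ℂ) (hamiltonian_apply u ψ)
  have h2 := congrArg (fun x => ⟪(ψ : BosonQubit N), x⟫_ℂ) (hamiltonian_apply u χ)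
  simp only [inner_add_left, inner_add_right, key, key'] at h1 h2
  rw [h1, h2, add_comm]

/-- The vector `w` stands for the square root of (number + 1) applied to ψ. Only the norms of its
components matter, so the same `w` also controls ψ dressed by a sector unitary. -/
theorem norm_annihilation_le (ψ : bosonDomain N) (w : BosonQubit N)
    (hw : ∀ n : ℕ, ‖w n‖ ^ 2 = (n + 1) * ‖(ψ : BosonQubit N) n‖ ^ 2) :
    ‖annihilation N ψ‖ ≤ ‖w‖ := by
  refine (sq_le_sq₀ (norm_nonneg _) (norm_nonneg _)).1 ?_
  have h := (hasSum_nat_add_iff' 1).2 (hasSum_norm_sq w)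
  refine (hasSum_le (fun n => ?_) (hasSum_norm_sq (annihilation N ψ)) h).trans ?_
  · rw [hw, annihilation_apply, norm_smul, mul_pow, norm_real, Real.norm_eq_abs, sq_abs,
      Real.sq_sqrt (by positivity)]
    push_cast
    gcongr
    linarith
  · simp

theorem norm_creation_le (ψ : bosonDomain N) (w : BosonQubit N)
    (hw : ∀ n : ℕ, ‖w n‖ ^ 2 = (n + 1) * ‖(ψ : BosonQubit N) n‖ ^ 2) :
    ‖creation N ψ‖ ≤ ‖w‖ := by
  refine (sq_le_sq₀ (norm_nonneg _) (norm_nonneg _)).1 ?_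
  have h := (hasSum_nat_add_iff' 1).2 (hasSum_norm_sq (creation N ψ))
  simp only [Finset.sum_range_one, creation_apply_zero, norm_zero, ne_eq, OfNat.ofNat_ne_zero,
    not_false_eq_true, zero_pow, sub_zero] at h
  refine hasSum_le (fun n => ?_) h (hasSum_norm_sq w)
  rw [hw, creation_apply_succ, norm_smul, mul_pow, norm_real, Real.norm_eq_abs, sq_abs,
      Real.sq_sqrt (by positivity)]

theorem norm_hamiltonian_le (u : ℕ → QReg (Fin N) ≃ₗᵢ[ℂ] QReg (Fin N))
    (ψ : (hamiltonian (sectorUnitary u)).domain) (w : BosonQubit N)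
    (hw : ∀ n : ℕ, ‖w n‖ ^ 2 = (n + 1) * ‖(ψ : BosonQubit N) n‖ ^ 2) :
    ‖hamiltonian (sectorUnitary u) ψ‖ ≤ 2 * ‖w‖ := by
  rw [hamiltonian_apply]
  refine (norm_add_le _ _).trans ?_
  rw [LinearIsometryEquiv.norm_map, two_mul]
  refine add_le_add (norm_annihilation_le _ w hw) (norm_creation_le _ w fun n => ?_)
  rw [hw, sectorUnitary_symm_apply, LinearIsometryEquiv.norm_map]

/-- The states with finitely many bosons. -/
def finiteBoson (N : ℕ) : Submodule ℂ (BosonQubit N) where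
  carrier := {ψ | ∃ m, ∀ n, m ≤ n → ψ n = 0}
  zero_mem' := ⟨0, fun n _ => rfl⟩
  add_mem' := by
    rintro ψ χ ⟨a, ha⟩ ⟨b, hb⟩
    refine ⟨max a b, fun n hn => ?_⟩
    change ψ n + χ n = 0
    rw [ha n (le_of_max_le_left hn), hb n (le_of_max_le_right hn), add_zero]
  smul_mem' := by
    rintro c ψ ⟨a, ha⟩
    refine ⟨a, fun n hn => ?_⟩
    change c • ψ n = 0
    rw [ha n hn, smul_zero]

theorem finiteBoson_le_bosonDomain : finiteBoson N ≤ bosonDomain N := by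
  rintro ψ ⟨m, hm⟩
  rw [mem_bosonDomain_iff]
  refine summable_of_ne_finset_zero (s := Finset.range m) fun n hn => ?_
  rw [hm n (by simpa using hn)]
  simp

theorem finiteBoson_le_domain (u : ℕ → QReg (Fin N) ≃ₗᵢ[ℂ] QReg (Fin N)) :
    finiteBoson N ≤ (hamiltonian (sectorUnitary u)).domain :=
  fun _ h => mem_domain_hamiltonian.2 (finiteBoson_le_bosonDomain h)

theorem hamiltonian_apply_succ (u : ℕ → QReg (Fin N) ≃ₗᵢ[ℂ] QReg (Fin N))
    (ψ : (hamiltonian (sectorUnitary u)).domain) (n : ℕ) :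
    hamiltonian (sectorUnitary u) ψ (n + 1) =
      ((Real.sqrt (n + 2) : ℝ) : ℂ) • u (n + 1) ((ψ : BosonQubit N) (n + 2)) +
      ((Real.sqrt (n + 1) : ℝ) : ℂ) • (u n).symm ((ψ : BosonQubit N) n) := by
  have h : hamiltonian (sectorUnitary u) ψ (n + 1) =
      u (n + 1) (((Real.sqrt ((n + 1 : ℕ) + 1) : ℝ) : ℂ) • (ψ : BosonQubit N) (n + 2)) +
      ((Real.sqrt (n + 1) : ℝ) : ℂ) • (u n).symm ((ψ : BosonQubit N) n) := rfl
  have h2 : ((n + 1 : ℕ) : ℝ) + 1 = n + 2 := by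
    push_cast
    ring
  rw [h, h2, map_smul]

theorem hamiltonian_apply_zero (u : ℕ → QReg (Fin N) ≃ₗᵢ[ℂ] QReg (Fin N))
    (ψ : (hamiltonian (sectorUnitary u)).domain) :
    hamiltonian (sectorUnitary u) ψ 0 = u 0 ((ψ : BosonQubit N) 1) := by
  have h : hamiltonian (sectorUnitary u) ψ 0 =
      u 0 (((Real.sqrt ((0 : ℕ) + 1) : ℝ) : ℂ) • (ψ : BosonQubit N) 1) + 0 := rfl
  rw [h]
  simp

theorem hamiltonian_eq_zero_of_le (u : ℕ → QReg (Fin N) ≃ₗᵢ[ℂ] QReg (Fin N))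
    (ψ : (hamiltonian (sectorUnitary u)).domain) {m : ℕ}
    (h : ∀ n, m ≤ n → (ψ : BosonQubit N) n = 0) (n : ℕ) (hn : m + 1 ≤ n) :
    hamiltonian (sectorUnitary u) ψ n = 0 := by
  obtain ⟨k, rfl⟩ : ∃ k, n = k + 1 := ⟨n - 1, by omega⟩
  rw [hamiltonian_apply_succ, h k (by omega), h (k + 2) (by omega)]
  simp

/-- The Hamiltonian on the states with finitely many bosons. -/
def finiteHamiltonian (u : ℕ → QReg (Fin N) ≃ₗᵢ[ℂ] QReg (Fin N)) :
    finiteBoson N →ₗ[ℂ] finiteBoson N :=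
  ((hamiltonian (sectorUnitary u)).toFun ∘ₗ
    Submodule.inclusion (finiteBoson_le_domain u)).codRestrict (finiteBoson N) fun ψ => by
      obtain ⟨m, hm⟩ := ψ.2
      exact ⟨m + 1, hamiltonian_eq_zero_of_le u ⟨ψ, finiteBoson_le_domain u ψ.2⟩ hm⟩

theorem coe_finiteHamiltonian (u : ℕ → QReg (Fin N) ≃ₗᵢ[ℂ] QReg (Fin N)) (ψ : finiteBoson N) :
    (finiteHamiltonian u ψ : BosonQubit N) =
      hamiltonian (sectorUnitary u) ⟨ψ, finiteBoson_le_domain u ψ.2⟩ := rfl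

/-- The part of `ψ` with fewer than `m` bosons. -/
def truncation (ψ : BosonQubit N) (m : ℕ) : BosonQubit N :=
  ∑ i ∈ Finset.range m, lp.single 2 i (ψ i)

theorem truncation_apply (ψ : BosonQubit N) (m n : ℕ) :
    truncation (ψ : BosonQubit N) m n = if n < m then ψ n else 0 := by
  simp only [truncation, lp.coeFn_sum, Finset.sum_apply, lp.single_apply]
  simp [Finset.sum_pi_single]

theorem truncation_mem (ψ : BosonQubit N) (m : ℕ) : truncation (ψ : BosonQubit N) m ∈ finiteBoson N :=
  ⟨m, fun n hn => by rw [truncation_apply, if_neg (not_lt.2 hn)]⟩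

theorem tendsto_truncation (ψ : BosonQubit N) : Tendsto (truncation ψ) atTop (𝓝 ψ) :=
  (lp.hasSum_single (by norm_num) ψ).tendsto_sum_nat

theorem dense_finiteBoson : Dense (finiteBoson N : Set (BosonQubit N)) := fun ψ =>
  mem_closure_of_tendsto (tendsto_truncation ψ) (Eventually.of_forall (truncation_mem ψ))

/-- Finite-boson states form a core: H is dominated by the square root of (number + 1), and
truncations of a vector of the domain converge in that weighted norm. -/
theorem closure_graph_hamiltonian (u : ℕ → QReg (Fin N) ≃ₗᵢ[ℂ] QReg (Fin N)) :
    closure ((hamiltonian (sectorUnitary u)).graph : Set (BosonQubit N × BosonQubit N)) =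
      closure (Set.range fun f : finiteBoson N =>
        ((f : BosonQubit N), (finiteHamiltonian u f : BosonQubit N))) := by
  refine subset_antisymm (closure_minimal ?_ isClosed_closure) (closure_mono ?_)
  · rintro ⟨x, y⟩ hxy
    obtain ⟨ψ, rfl, rfl⟩ := (LinearPMap.mem_graph_iff _).1 hxy
    have hsum : Summable fun n : ℕ => ‖((Real.sqrt (n + 1) : ℝ) : ℂ) • (ψ : BosonQubit N) n‖ ^ 2 := by
      refine ((mem_bosonDomain_iff.1 (mem_domain_hamiltonian.1 ψ.2)).add
        (hasSum_norm_sq (ψ : BosonQubit N)).summable).congr fun n => ?_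
      rw [norm_smul, mul_pow, norm_real, Real.norm_eq_abs, sq_abs, Real.sq_sqrt (by positivity)]
      ring
    let w : BosonQubit N := ⟨_, memℓp_two_iff.2 hsum⟩
    have hw : ∀ n : ℕ, w n = ((Real.sqrt (n + 1) : ℝ) : ℂ) • (ψ : BosonQubit N) n := fun n => rfl
    refine mem_closure_of_tendsto (f := fun m => ((truncation (ψ : BosonQubit N) m : BosonQubit N),
      (finiteHamiltonian u ⟨truncation (ψ : BosonQubit N) m, truncation_mem (ψ : BosonQubit N) m⟩ : BosonQubit N)))
      ((tendsto_truncation (ψ : BosonQubit N)).prodMk_nhds ?_)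
      (Eventually.of_forall fun m => ⟨⟨truncation (ψ : BosonQubit N) m, truncation_mem (ψ : BosonQubit N) m⟩, rfl⟩) (b := atTop)
    rw [tendsto_iff_norm_sub_tendsto_zero]
    have hz : Tendsto (fun m => 2 * ‖truncation w m - w‖) atTop (𝓝 0) := by
      simpa using (tendsto_iff_norm_sub_tendsto_zero.1 (tendsto_truncation w)).const_mul 2
    refine squeeze_zero (fun _ => norm_nonneg _) (fun m => ?_) hz
    rw [coe_finiteHamiltonian, ← LinearPMap.map_sub]
    refine norm_hamiltonian_le u _ _ fun n => ?_
    change ‖truncation w m n - w n‖ ^ 2 =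
      (n + 1) * ‖truncation (ψ : BosonQubit N) m n - (ψ : BosonQubit N) n‖ ^ 2
    simp only [truncation_apply, hw]
    split_ifs
    · simp
    · rw [zero_sub, zero_sub, norm_neg, norm_neg, norm_smul, mul_pow, norm_real, Real.norm_eq_abs,
        sq_abs, Real.sq_sqrt (by positivity)]
  · rintro _ ⟨f, rfl⟩
    exact (hamiltonian (sectorUnitary u)).mem_graph ⟨f, finiteBoson_le_domain u f.2⟩

theorem norm_finiteHamiltonian_le (u : ℕ → QReg (Fin N) ≃ₗᵢ[ℂ] QReg (Fin N)) (f : finiteBoson N)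
    {m : ℕ} (hm : ∀ n, m ≤ n → (f : BosonQubit N) n = 0) :
    ‖(finiteHamiltonian u f : BosonQubit N)‖ ≤ 2 * Real.sqrt m * ‖(f : BosonQubit N)‖ := by
  have hle : ∀ n : ℕ, ‖((Real.sqrt (n + 1) : ℝ) : ℂ) • (f : BosonQubit N) n‖ ^ 2
      ≤ m * ‖(f : BosonQubit N) n‖ ^ 2 := by
    intro n
    rw [norm_smul, mul_pow, norm_real, Real.norm_eq_abs, sq_abs, Real.sq_sqrt (by positivity)]
    by_cases h : m ≤ n
    · simp [hm n h]
    · gcongr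
      exact_mod_cast not_le.1 h
  have hs := (hasSum_norm_sq (f : BosonQubit N)).mul_left (m : ℝ)
  let w : BosonQubit N := ⟨fun n => ((Real.sqrt (n + 1) : ℝ) : ℂ) • (f : BosonQubit N) n,
    memℓp_two_iff.2 (Summable.of_nonneg_of_le (fun _ => by positivity) hle hs.summable)⟩
  have h1 : ‖(finiteHamiltonian u f : BosonQubit N)‖ ≤ 2 * ‖w‖ := by
    refine norm_hamiltonian_le u _ w fun n => ?_
    change ‖((Real.sqrt (n + 1) : ℝ) : ℂ) • (f : BosonQubit N) n‖ ^ 2 = _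
    rw [norm_smul, mul_pow, norm_real, Real.norm_eq_abs, sq_abs, Real.sq_sqrt (by positivity)]
    rfl
  have h2 : ‖w‖ ^ 2 ≤ (Real.sqrt m * ‖(f : BosonQubit N)‖) ^ 2 := by
    rw [mul_pow, Real.sq_sqrt (by positivity)]
    exact hasSum_le hle (hasSum_norm_sq w) hs
  have h3 := (sq_le_sq₀ (norm_nonneg _) (by positivity)).1 h2
  linarith

theorem finiteHamiltonian_pow_eq_zero (u : ℕ → QReg (Fin N) ≃ₗᵢ[ℂ] QReg (Fin N))
    (f : finiteBoson N) {m : ℕ} (hm : ∀ n, m ≤ n → (f : BosonQubit N) n = 0) (k n : ℕ)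
    (hn : m + k ≤ n) : ((finiteHamiltonian u ^ k) f : BosonQubit N) n = 0 := by
  induction k generalizing n with
  | zero => exact hm n hn
  | succ k ih =>
    rw [pow_succ', Module.End.mul_apply, coe_finiteHamiltonian]
    exact hamiltonian_eq_zero_of_le u _ (m := m + k) (fun j hj => ih j hj) n hn

theorem hasEntireVectors_finiteHamiltonian (u : ℕ → QReg (Fin N) ≃ₗᵢ[ℂ] QReg (Fin N)) :
    HasEntireVectors (finiteHamiltonian u) := by
  intro f r hr
  obtain ⟨m, hm⟩ := f.2
  refine summable_of_ratio_norm_eventually_le (r := 1 / 2) (by norm_num) ?_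
  -- One more power of H costs a factor 2√(m + k), against k + 1 from the factorial. With k ≥ m and
  -- k ≥ 32r², 4r²(m + k) ≤ k²/4, so the ratio of consecutive terms is at most 1/2.
  obtain ⟨K, hK⟩ := exists_nat_ge (32 * r ^ 2)
  filter_upwards [eventually_ge_atTop (max m K)] with k hk
  have hmk : (m : ℝ) ≤ k := by exact_mod_cast le_of_max_le_left hk
  have hKk : (K : ℝ) ≤ k := by exact_mod_cast le_of_max_le_right hk
  have h1 := norm_finiteHamiltonian_le u ((finiteHamiltonian u ^ k) f)
    (finiteHamiltonian_pow_eq_zero u f hm k)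
  rw [← Module.End.mul_apply, ← pow_succ'] at h1
  have h2 : r * (2 * Real.sqrt ((m + k : ℕ) : ℝ)) ≤ (k + 1) / 2 := by
    refine (sq_le_sq₀ (by positivity) (by positivity)).1 ?_
    rw [mul_pow, mul_pow, Real.sq_sqrt (by positivity)]
    push_cast
    have : r ^ 2 * ((m : ℝ) + k) ≤ (k / 32) * (2 * k) := by
      gcongr <;> linarith
    nlinarith
  rw [Real.norm_of_nonneg (by positivity), Real.norm_of_nonneg (by positivity)]
  calc r ^ (k + 1) / ((k + 1)! : ℝ) * ‖((finiteHamiltonian u ^ (k + 1)) f : BosonQubit N)‖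
      ≤ r ^ (k + 1) / ((k + 1)! : ℝ) *
        (2 * Real.sqrt ((m + k : ℕ) : ℝ) * ‖((finiteHamiltonian u ^ k) f : BosonQubit N)‖) := by
        gcongr
    _ = (r * (2 * Real.sqrt ((m + k : ℕ) : ℝ))) / (k + 1) *
        (r ^ k / (k ! : ℝ) * ‖((finiteHamiltonian u ^ k) f : BosonQubit N)‖) := by
        rw [Nat.factorial_succ]
        push_cast
        field_simp
        ring
    _ ≤ 1 / 2 * (r ^ k / (k ! : ℝ) * ‖((finiteHamiltonian u ^ k) f : BosonQubit N)‖) := by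
        refine mul_le_mul_of_nonneg_right ?_ (by positivity)
        rw [div_le_iff₀ (by positivity)]
        linarith

theorem inner_finiteHamiltonian (u : ℕ → QReg (Fin N) ≃ₗᵢ[ℂ] QReg (Fin N)) (f g : finiteBoson N) :
    ⟪(finiteHamiltonian u f : BosonQubit N), (g : BosonQubit N)⟫_ℂ =
      ⟪(f : BosonQubit N), (finiteHamiltonian u g : BosonQubit N)⟫_ℂ :=
  inner_hamiltonian u ⟨f, finiteBoson_le_domain u f.2⟩ ⟨g, finiteBoson_le_domain u g.2⟩

/-- The matrix elements `⟨n| (b + b†)ᵏ |0⟩`. -/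
def vacuumElement : ℕ → ℕ → ℝ
  | 0, 0 => 1
  | 0, _ + 1 => 0
  | k + 1, 0 => vacuumElement k 1
  | k + 1, n + 1 =>
    Real.sqrt (n + 1) * vacuumElement k n + Real.sqrt (n + 2) * vacuumElement k (n + 2)

/-- The generating function of these numbers over k is the coherent-state amplitude e^{s²/2}
sⁿ/√(n!). The closed form and the vanishing are proved together because the recursion at j = 0 needs
the neighbour n + 2 to vanish. -/
theorem vacuumElement_eq (k n : ℕ) :
    (∀ j, k = n + 2 * j → vacuumElement k n = k ! / (2 ^ j * j ! * Real.sqrt (n !))) ∧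
      ((∀ j, k ≠ n + 2 * j) → vacuumElement k n = 0) := by
  induction k generalizing n with
  | zero =>
    cases n with
    | zero =>
      refine ⟨fun j hj => ?_, fun h => absurd rfl (h 0)⟩
      obtain rfl : j = 0 := by omega
      simp [vacuumElement]
    | succ n => exact ⟨fun j hj => by omega, fun _ => rfl⟩
  | succ k ih =>
    cases n with
    | zero =>
      refine ⟨fun j hj => ?_, fun h => ?_⟩
      · obtain ⟨i, rfl⟩ : ∃ i, j = i + 1 := ⟨j - 1, by omega⟩
        rw [vacuumElement, (ih 1).1 i (by omega)]
        obtain rfl : k = 2 * i + 1 := by omega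
        simp only [Nat.factorial_succ, Nat.factorial_zero, pow_succ]
        push_cast
        simp only [Real.sqrt_one]
        field_simp
        ring
      · rw [vacuumElement, (ih 1).2 fun j hj => h (j + 1) (by omega)]
    | succ n =>
      refine ⟨fun j hj => ?_, fun h => ?_⟩
      · obtain rfl : k = n + 2 * j := by omega
        rw [vacuumElement, (ih n).1 j rfl]
        have hs1 : Real.sqrt ((n + 1)! : ℝ) = Real.sqrt (n + 1) * Real.sqrt (n !) := by
          rw [Nat.factorial_succ, Nat.cast_mul, Real.sqrt_mul (by positivity)]
          push_cast; rfl
        have hs2 : Real.sqrt ((n + 2)! : ℝ) =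
            Real.sqrt (n + 2) * (Real.sqrt (n + 1) * Real.sqrt (n !)) := by
          rw [Nat.factorial_succ, Nat.cast_mul, Real.sqrt_mul (by positivity), hs1]
          push_cast; ring_nf
        have hp0 : Real.sqrt (n ! : ℝ) ≠ 0 := by positivity
        have hp1 : Real.sqrt (n + 1 : ℝ) ≠ 0 := by positivity
        have hp2 : Real.sqrt (n + 2 : ℝ) ≠ 0 := by positivity
        have hq : Real.sqrt (n + 1 : ℝ) ^ 2 = n + 1 := Real.sq_sqrt (by positivity)
        cases j with
        | zero =>
          rw [(ih (n + 2)).2 fun j => by omega, hs1]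
          simp only [mul_zero, add_zero, pow_zero, Nat.factorial_zero, Nat.factorial_succ]
          push_cast
          field_simp
          rw [hq]
        | succ i =>
          rw [(ih (n + 2)).1 i (by omega), hs1, hs2, Nat.factorial_succ (n + 2 * (i + 1)),
            Nat.factorial_succ i, pow_succ]
          push_cast
          field_simp
          rw [hq]
          ring
      · rw [vacuumElement, (ih n).2 fun j hj => h j (by omega),
          (ih (n + 2)).2 fun j hj => h (j + 1) (by omega)]
        simp

theorem hasSum_vacuumElement (t : ℝ) (n : ℕ) :
    HasSum (fun k => (-(I * t)) ^ k / (k ! : ℂ) * vacuumElement k n)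
      ((-(I * t)) ^ n / (Real.sqrt (n !) : ℝ) * Complex.exp (-(t ^ 2 / 2))) := by
  have hinj : Function.Injective fun j => n + 2 * j := fun a b h => by
    simp only at h; omega
  have h := (NormedSpace.expSeries_div_hasSum_exp (-((t : ℂ) ^ 2 / 2))).mul_left
    ((-(I * t)) ^ n / ((Real.sqrt (n !) : ℝ) : ℂ))
  rw [← Complex.exp_eq_exp_ℂ] at h
  rw [← hinj.hasSum_iff]
  · refine h.congr_fun fun j => ?_
    simp only [Function.comp_apply]
    rw [(vacuumElement_eq (n + 2 * j) n).1 j rfl, pow_add, pow_mul]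
    have h1 : (-(I * (t : ℂ))) ^ 2 = -(t : ℂ) ^ 2 := by
      linear_combination (t : ℂ) ^ 2 * I_sq
    have h2 : (-((t : ℂ) ^ 2 / 2)) ^ j = (-(t : ℂ) ^ 2) ^ j / 2 ^ j := by
      rw [← div_pow, neg_div]
    have h3 : ((n + 2 * j)! : ℂ) ≠ 0 := by exact_mod_cast (n + 2 * j).factorial_ne_zero
    rw [h1, h2]
    push_cast
    field_simp
  · intro k hk
    rw [(vacuumElement_eq k n).2 fun j hj => hk ⟨j, hj.symm⟩]
    simp

theorem fockState_mem (n : ℕ) (ξ : QReg (Fin N)) : fockState n ξ ∈ finiteBoson N := by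
  refine ⟨n + 1, fun k hk => ?_⟩
  rw [fockState, lp.single_apply, Pi.single_eq_of_ne (by omega)]

/-- The hypothesis `hu` says that dressing sector n by `D n` intertwines b + b† with H, so the
coefficients are those of b + b†. -/
theorem finiteHamiltonian_pow_vacuum {u D : ℕ → QReg (Fin N) ≃ₗᵢ[ℂ] QReg (Fin N)}
    (h0 : ∀ ξ, D 0 ξ = ξ) (hu : ∀ n ξ, u n (D (n + 1) ξ) = D n ξ) (ξ : QReg (Fin N)) (k n : ℕ) :
    ((finiteHamiltonian u ^ k) ⟨fockState 0 ξ, fockState_mem 0 ξ⟩ : BosonQubit N) n =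
      (vacuumElement k n : ℂ) • D n ξ := by
  have hu' : ∀ n ξ, (u n).symm (D n ξ) = D (n + 1) ξ := fun n ξ => by
    rw [← hu, LinearIsometryEquiv.symm_apply_apply]
  induction k generalizing n with
  | zero =>
    cases n with
    | zero => simp [fockState, vacuumElement, h0]
    | succ n => simp [fockState, vacuumElement]
  | succ k ih =>
    rw [pow_succ', Module.End.mul_apply, coe_finiteHamiltonian]
    cases n with
    | zero => rw [hamiltonian_apply_zero, ih, map_smul, hu, vacuumElement]
    | succ n =>
      rw [hamiltonian_apply_succ, ih, ih, map_smul, map_smul, hu, hu', vacuumElement,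
        smul_smul, smul_smul, ← add_smul]
      congr 1
      push_cast
      ring

/-- For every sequence `D` of unitaries on the qubits with `D 0 = 1` there is a Hamiltonian
`U b + b† U†` under which the vacuum evolves into a superposition of the states `|n⟩ ⊗ D n ξ` with
Poissonian boson number. -/
theorem exists_timeEvolution_poisson (D : ℕ → QReg (Fin N) ≃ₗᵢ[ℂ] QReg (Fin N))
    (h0 : ∀ ξ, D 0 ξ = ξ) :
    ∃ U : BosonQubit N ≃ₗᵢ[ℂ] BosonQubit N, NumberPreserving U ∧
      ∃ V : ℝ → (BosonQubit N ≃ₗᵢ[ℂ] BosonQubit N), IsTimeEvolution (hamiltonian U) V ∧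
        ∀ (t : ℝ) (ξ : QReg (Fin N)) (A : QReg (Fin N) →L[ℂ] QReg (Fin N)),
          HasSum (fun n : ℕ => ((Real.exp (-t ^ 2) * ((t ^ 2) ^ n / n !) : ℝ) : ℂ) *
              ⟪D n ξ, A (D n ξ)⟫_ℂ)
            ⟪V t (fockState 0 ξ), idTensor A (V t (fockState 0 ξ))⟫_ℂ := by
  let u : ℕ → QReg (Fin N) ≃ₗᵢ[ℂ] QReg (Fin N) := fun n => (D (n + 1)).symm.trans (D n)
  have hu : ∀ n ξ, u n (D (n + 1) ξ) = D n ξ := fun n ξ => by simp [u]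
  have hA := hasEntireVectors_finiteHamiltonian u
  refine ⟨sectorUnitary u, numberPreserving_sectorUnitary u,
    expUnitary hA (inner_finiteHamiltonian u) dense_finiteBoson,
    isTimeEvolution_expUnitary hA _ _ _ (closure_graph_hamiltonian u), fun t ξ A => ?_⟩
  have hV : ∀ n, expUnitary hA (inner_finiteHamiltonian u) dense_finiteBoson t (fockState 0 ξ) n =
      ((-(I * t)) ^ n / (Real.sqrt (n !) : ℝ) * Complex.exp (-(t ^ 2 / 2))) • D n ξ := by
    intro n
    have e : expUnitary hA (inner_finiteHamiltonian u) dense_finiteBoson t (fockState 0 ξ) =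
        expSum hA t ⟨fockState 0 ξ, fockState_mem 0 ξ⟩ :=
      expExtend_coe hA (inner_finiteHamiltonian u) dense_finiteBoson t ⟨_, fockState_mem 0 ξ⟩
    rw [e]
    have h1 := (hasSum_expSum hA t ⟨fockState 0 ξ, fockState_mem 0 ξ⟩).mapL
      (lp.evalCLM ℂ (fun _ : ℕ => QReg (Fin N)) 2 n)
    refine h1.unique (((hasSum_vacuumElement t n).smul_const (D n ξ)).congr_fun fun k => ?_)
    rw [mul_smul, ← finiteHamiltonian_pow_vacuum h0 hu ξ k n]
    rfl
  -- The observable is diagonal in the boson number, so phases cancel and only the squared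
  -- amplitudes, the Poisson weights, remain.
  refine (lp.hasSum_inner _ _).congr_fun fun n => ?_
  have e : ∀ ψ : BosonQubit N, idTensor A ψ n = A (ψ n) := fun ψ => rfl
  rw [e, hV, map_smul, inner_smul_left, inner_smul_right, ← mul_assoc, ← Complex.normSq_eq_conj_mul_self]
  congr 2
  have h1 : Complex.exp (-((t : ℂ) ^ 2 / 2)) = ((Real.exp (-(t ^ 2 / 2)) : ℝ) : ℂ) := by
    push_cast; rfl
  rw [h1, map_mul, map_div₀, map_pow, normSq_ofReal, normSq_ofReal, ← Real.exp_add,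
    Real.mul_self_sqrt (by positivity)]
  have h2 : normSq (-(I * (t : ℂ))) = t ^ 2 := by
    rw [normSq_neg, map_mul, normSq_I, normSq_ofReal]
    ring
  rw [h2]
  ring_nf

end Boson
end

noncomputable section

/-! ### Circuits -/

section Circuits

open Finset
open scoped Kronecker

section Unitary

variable {n : Type} [Fintype n] [DecidableEq n]

theorem sum_norm_sq_unitary_mulVec (u : Matrix.unitaryGroup n ℂ) (v : n → ℂ) :
    ∑ b, ‖∑ a, (u : Matrix n n ℂ) b a * v a‖ ^ 2 = ∑ a, ‖v a‖ ^ 2 := by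
  have key : ∀ w : n → ℂ, ((∑ b, ‖w b‖ ^ 2 : ℝ) : ℂ) = star w ⬝ᵥ w := by
    intro w
    simp only [dotProduct, Pi.star_apply, RCLike.star_def, Complex.conj_mul']
    push_cast
    rfl
  have h : ∀ b, ∑ a, (u : Matrix n n ℂ) b a * v a = ((u : Matrix n n ℂ).mulVec v) b := fun b => rfl
  simp only [h]
  refine Complex.ofReal_injective ?_
  rw [key, key, Matrix.star_mulVec, Matrix.dotProduct_mulVec, Matrix.vecMul_vecMul,
    ← Matrix.star_eq_conjTranspose, Matrix.UnitaryGroup.star_mul_self, Matrix.vecMul_one]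

omit [DecidableEq n] in
theorem sum_norm_sq_mulVec_le {d : n → n → ℂ} {δ : ℝ} (hd : ∀ b a, ‖d b a‖ ≤ δ) (v : n → ℂ) :
    ∑ b, ‖∑ a, d b a * v a‖ ^ 2 ≤ (Fintype.card n * δ) ^ 2 * ∑ a, ‖v a‖ ^ 2 := by
  have h : ∀ b, ‖∑ a, d b a * v a‖ ^ 2 ≤ Fintype.card n * δ ^ 2 * ∑ a, ‖v a‖ ^ 2 := by
    intro b
    have h1 : ‖∑ a, d b a * v a‖ ≤ ∑ a, δ * ‖v a‖ :=
      (norm_sum_le _ _).trans (sum_le_sum fun a _ => by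
        rw [norm_mul]
        exact mul_le_mul_of_nonneg_right (hd b a) (norm_nonneg _))
    calc ‖∑ a, d b a * v a‖ ^ 2 ≤ (∑ a, δ * ‖v a‖) ^ 2 := by gcongr
      _ ≤ Fintype.card n * ∑ a, (δ * ‖v a‖) ^ 2 := sq_sum_le_card_mul_sum_sq
      _ = Fintype.card n * δ ^ 2 * ∑ a, ‖v a‖ ^ 2 := by
        simp only [mul_pow, ← mul_sum]
        ring
  calc ∑ b, ‖∑ a, d b a * v a‖ ^ 2
      ≤ ∑ _b : n, Fintype.card n * δ ^ 2 * ∑ a, ‖v a‖ ^ 2 := sum_le_sum fun b _ => h b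
    _ = (Fintype.card n * δ) ^ 2 * ∑ a, ‖v a‖ ^ 2 := by
      rw [sum_const, card_univ, nsmul_eq_mul]
      ring

end Unitary

variable {ι : Type} [Fintype ι] [DecidableEq ι]

/-- For each fixed shift of the bit `i` the update is an involution, hence only permutes the sum.
This reduces norms after a gate to norms for its small matrix with the other qubits frozen. -/
theorem sum_sum_update {M : Type} [AddCommMonoid M] (F : (ι → Fin 2) → M) (i : ι) :
    ∑ x, ∑ a, F (Function.update x i a) = 2 • ∑ x, F x := by
  have h : ∀ x : ι → Fin 2, ∑ a, F (Function.update x i a) =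
      ∑ a, F (Function.update x i (x i + a)) := fun x =>
    (Equiv.sum_comp (Equiv.addLeft (x i)) fun a => F (Function.update x i a)).symm
  have hb : ∀ a : Fin 2, ∑ x : ι → Fin 2, F (Function.update x i (x i + a)) = ∑ x, F x := by
    intro a
    have hinv : Function.Involutive fun x : ι → Fin 2 => Function.update x i (x i + a) := by
      intro x
      have : x i + a + a = x i := by
        rw [add_assoc]
        have h2 : ∀ a : Fin 2, a + a = 0 := by decide
        rw [h2, add_zero]
      simp [this]
    exact Equiv.sum_comp hinv.toPerm F
  simp only [h]
  rw [sum_comm]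
  simp [hb]

theorem sum_sum_update_update {M : Type} [AddCommMonoid M] (F : (ι → Fin 2) → M) (i j : ι) :
    ∑ x, ∑ p : Fin 2 × Fin 2, F (Function.update (Function.update x i p.1) j p.2) =
      4 • ∑ x, F x := by
  simp only [Fintype.sum_prod_type]
  rw [sum_sum_update (fun x => ∑ b, F (Function.update x j b)) i, sum_sum_update F j, smul_smul]
  norm_num

omit [Fintype ι] in
theorem update_update_update_update {α : ι → Type} (x : ∀ i, α i) {i j : ι} (hij : i ≠ j)
    (a c : α i) (b d : α j) :
    Function.update (Function.update (Function.update (Function.update x i a) j b) i c) j d =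
      Function.update (Function.update x i c) j d := by
  rw [Function.update_comm hij.symm, Function.update_idem, Function.update_idem]

/-- The average of `‖d φ‖²`, for a matrix `d` acting on the qubits `i` and `j`, over the values of
these qubits. -/
theorem four_mul_sum_norm_sq (d : Fin 2 × Fin 2 → Fin 2 × Fin 2 → ℂ) (φ : (ι → Fin 2) → ℂ)
    {i j : ι} (hij : i ≠ j) :
    4 * ∑ x : ι → Fin 2,
      ‖∑ p, d (x i, x j) p * φ (Function.update (Function.update x i p.1) j p.2)‖ ^ 2 =
    ∑ x : ι → Fin 2, ∑ q,
      ‖∑ p, d q p * φ (Function.update (Function.update x i p.1) j p.2)‖ ^ 2 := by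
  have h := sum_sum_update_update (fun x : ι → Fin 2 =>
      ‖∑ p, d (x i, x j) p * φ (Function.update (Function.update x i p.1) j p.2)‖ ^ 2) i j
  simp only [update_update_update_update _ hij, Function.update_self,
    Function.update_of_ne hij] at h
  rw [h, nsmul_eq_mul]
  norm_cast

namespace QGate

theorem one_apply (i : ι) (u : Matrix.unitaryGroup (Fin 2) ℂ) (φ : QReg ι) (x : ι → Fin 2) :
    (one i u).apply φ x =
      ∑ a : Fin 2, (u : Matrix (Fin 2) (Fin 2) ℂ) (x i) a * φ (Function.update x i a) := rfl

theorem two_apply (i j : ι) (hij : i ≠ j) (u : Matrix.unitaryGroup (Fin 2 × Fin 2) ℂ)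
    (φ : QReg ι) (x : ι → Fin 2) :
    (two i j hij u).apply φ x = ∑ p : Fin 2 × Fin 2,
      (u : Matrix (Fin 2 × Fin 2) (Fin 2 × Fin 2) ℂ) (x i, x j) p
        * φ (Function.update (Function.update x i p.1) j p.2) := rfl

theorem norm_apply (g : QGate ι) (φ : QReg ι) : ‖g.apply φ‖ = ‖φ‖ := by
  refine (sq_eq_sq₀ (norm_nonneg _) (norm_nonneg _)).1 ?_
  rw [EuclideanSpace.norm_sq_eq, EuclideanSpace.norm_sq_eq]
  cases g with
  | one i u =>
    simp only [one_apply]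
    have h := sum_sum_update (fun x : ι → Fin 2 =>
      ‖∑ a : Fin 2, (u : Matrix (Fin 2) (Fin 2) ℂ) (x i) a * φ (Function.update x i a)‖ ^ 2) i
    simp only [Function.update_idem, Function.update_self, sum_norm_sq_unitary_mulVec] at h
    rw [sum_sum_update (fun x => ‖φ x‖ ^ 2)] at h
    simpa using h.symm
  | two i j hij u =>
    simp only [two_apply]
    have h := four_mul_sum_norm_sq (fun q p => (u : Matrix (Fin 2 × Fin 2) _ ℂ) q p) φ hij
    simp only [sum_norm_sq_unitary_mulVec] at h
    rw [sum_sum_update_update (fun x => ‖φ x‖ ^ 2)] at h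
    simpa using h

theorem norm_two_sub_two_le {i j : ι} (hij : i ≠ j) {u v : Matrix.unitaryGroup (Fin 2 × Fin 2) ℂ}
    {δ : ℝ} (hδ : 0 ≤ δ) (h : ∀ q p, ‖(u : Matrix (Fin 2 × Fin 2) _ ℂ) q p - v q p‖ ≤ δ)
    (φ : QReg ι) : ‖(two i j hij u).apply φ - (two i j hij v).apply φ‖ ≤ 4 * δ * ‖φ‖ := by
  refine (sq_le_sq₀ (norm_nonneg _) (by positivity)).1 ?_
  rw [mul_pow, EuclideanSpace.norm_sq_eq, EuclideanSpace.norm_sq_eq]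
  simp only [PiLp.sub_apply, two_apply, ← sum_sub_distrib, ← sub_mul]
  have h1 := four_mul_sum_norm_sq (fun q p => (u : Matrix (Fin 2 × Fin 2) _ ℂ) q p - v q p) φ hij
  have h2 := sum_le_sum (s := univ) fun (x : ι → Fin 2) _ => sum_norm_sq_mulVec_le h
    fun p => φ (Function.update (Function.update x i p.1) j p.2)
  rw [← h1, ← mul_sum, sum_sum_update_update (fun x => ‖φ x‖ ^ 2)] at h2
  simp only [Fintype.card_prod, Fintype.card_fin, nsmul_eq_mul] at h2
  norm_num at h2
  linarith

theorem one_one (i : ι) (u v : Matrix.unitaryGroup (Fin 2) ℂ) :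
    (one i u).apply ∘ₗ (one i v).apply = (one i (u * v)).apply := by
  ext φ x
  simp only [LinearMap.comp_apply, one_apply, Function.update_self, Function.update_idem,
    Matrix.UnitaryGroup.mul_val, Matrix.mul_apply, sum_mul, mul_sum]
  rw [sum_comm]
  simp only [mul_assoc]

theorem one_comm {i k : ι} (h : i ≠ k) (u v : Matrix.unitaryGroup (Fin 2) ℂ) :
    (one i u).apply ∘ₗ (one k v).apply = (one k v).apply ∘ₗ (one i u).apply := by
  ext φ x
  simp only [LinearMap.comp_apply, one_apply, Function.update_of_ne h, Function.update_of_ne h.symm,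
    mul_sum]
  rw [sum_comm]
  refine sum_congr rfl fun a _ => sum_congr rfl fun b _ => ?_
  rw [Function.update_comm h]
  ring

theorem one_two_comm {i j k : ι} (hij : i ≠ j) (hi : i ≠ k) (hj : j ≠ k)
    (u : Matrix.unitaryGroup (Fin 2 × Fin 2) ℂ) (v : Matrix.unitaryGroup (Fin 2) ℂ) :
    (two i j hij u).apply ∘ₗ (one k v).apply = (one k v).apply ∘ₗ (two i j hij u).apply := by
  ext φ x
  simp only [LinearMap.comp_apply, one_apply, two_apply, Function.update_of_ne hi,
    Function.update_of_ne hj, Function.update_of_ne hi.symm, Function.update_of_ne hj.symm, mul_sum]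
  rw [sum_comm]
  refine sum_congr rfl fun a _ => sum_congr rfl fun b _ => ?_
  rw [Function.update_comm hj, Function.update_comm hi]
  ring

theorem kronecker_mem_unitary (u v : Matrix.unitaryGroup (Fin 2) ℂ) :
    (u : Matrix (Fin 2) (Fin 2) ℂ) ⊗ₖ (v : Matrix (Fin 2) (Fin 2) ℂ) ∈
      Matrix.unitaryGroup (Fin 2 × Fin 2) ℂ :=
  Matrix.kronecker_mem_unitary u.2 v.2

theorem two_one_left {i j : ι} (hij : i ≠ j) (u : Matrix.unitaryGroup (Fin 2 × Fin 2) ℂ)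
    (v : Matrix.unitaryGroup (Fin 2) ℂ) :
    ∃ w, (two i j hij u).apply ∘ₗ (one i v).apply = (two i j hij w).apply := by
  refine ⟨u * ⟨_, kronecker_mem_unitary v 1⟩, ?_⟩
  ext φ x
  simp only [LinearMap.comp_apply, one_apply, two_apply, Matrix.UnitaryGroup.mul_val,
    Matrix.mul_apply, Function.update_self, Function.update_of_ne hij,
    Matrix.kroneckerMap_apply, Fintype.sum_prod_type, Fin.sum_univ_two]
  simp [Function.update_comm hij.symm]
  ring

theorem two_one_right {i j : ι} (hij : i ≠ j) (u : Matrix.unitaryGroup (Fin 2 × Fin 2) ℂ)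
    (v : Matrix.unitaryGroup (Fin 2) ℂ) :
    ∃ w, (two i j hij u).apply ∘ₗ (one j v).apply = (two i j hij w).apply := by
  refine ⟨u * ⟨_, kronecker_mem_unitary 1 v⟩, ?_⟩
  ext φ x
  simp only [LinearMap.comp_apply, one_apply, two_apply, Matrix.UnitaryGroup.mul_val,
    Matrix.mul_apply, Function.update_self, Function.update_idem,
    Matrix.kroneckerMap_apply, Fintype.sum_prod_type, Fin.sum_univ_two]
  simp
  ring

theorem two_id {i j : ι} (hij : i ≠ j) : (two i j hij 1).apply = LinearMap.id := by
  ext φ x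
  simp [two_apply, Matrix.one_apply]

end QGate

theorem zeroProj_apply (i : ι) (φ : QReg ι) (x : ι → Fin 2) :
    zeroProj i φ x = if x i = 0 then φ x else 0 := rfl

theorem inner_zeroProj (i : ι) (φ : QReg ι) :
    inner ℂ φ (zeroProj i φ) = ((‖zeroProj i φ‖ ^ 2 : ℝ) : ℂ) := by
  rw [PiLp.inner_apply, EuclideanSpace.norm_sq_eq]
  push_cast
  refine sum_congr rfl fun x _ => ?_
  rw [zeroProj_apply]
  split_ifs
  · simp
  · simp

theorem norm_zeroProj_le (i : ι) (φ : QReg ι) : ‖zeroProj i φ‖ ≤ ‖φ‖ := by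
  refine (sq_le_sq₀ (norm_nonneg _) (norm_nonneg _)).1 ?_
  rw [EuclideanSpace.norm_sq_eq, EuclideanSpace.norm_sq_eq]
  refine sum_le_sum fun x _ => ?_
  rw [zeroProj_apply]
  split_ifs <;> simp

theorem zeroProj_one {i k : ι} (h : i ≠ k) (u : Matrix.unitaryGroup (Fin 2) ℂ) (φ : QReg ι) :
    zeroProj k ((QGate.one i u).apply φ) = (QGate.one i u).apply (zeroProj k φ) := by
  ext x
  simp only [zeroProj_apply, QGate.one_apply, Function.update_of_ne h.symm]
  split_ifs <;> simp

namespace QCircuit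

theorem apply_append (W W' : QCircuit ι) :
    QCircuit.apply (W ++ W') = QCircuit.apply W' ∘ₗ QCircuit.apply W := by
  induction W with
  | nil => rfl
  | cons g W ih => simp [QCircuit.apply, ih, LinearMap.comp_assoc]

theorem norm_apply (W : QCircuit ι) (φ : QReg ι) : ‖QCircuit.apply W φ‖ = ‖φ‖ := by
  induction W generalizing φ with
  | nil => rfl
  | cons g W ih => exact (ih _).trans (g.norm_apply φ)

end QCircuit

/-- Operators that are products of one-qubit gates on qubits outside `S`. -/
inductive LocalOff (S : Set ι) : (QReg ι →ₗ[ℂ] QReg ι) → Prop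
  | id : LocalOff S LinearMap.id
  | comp {A : QReg ι →ₗ[ℂ] QReg ι} (hA : LocalOff S A) {i : ι} (hi : i ∉ S)
      (u : Matrix.unitaryGroup (Fin 2) ℂ) : LocalOff S (A ∘ₗ (QGate.one i u).apply)

namespace LocalOff

variable {S : Set ι} {A : QReg ι →ₗ[ℂ] QReg ι}

theorem one_comp (hA : LocalOff S A) {i : ι} (hi : i ∉ S) (u : Matrix.unitaryGroup (Fin 2) ℂ) :
    LocalOff S ((QGate.one i u).apply ∘ₗ A) := by
  induction hA with
  | id => exact LocalOff.id.comp hi u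
  | comp _ hk v ih => exact ih.comp hk v

theorem mono (hA : LocalOff S A) {S' : Set ι} (h : S' ⊆ S) : LocalOff S' A := by
  induction hA with
  | id => exact LocalOff.id
  | comp _ hk v ih => exact ih.comp (fun hk' => hk (h hk')) v

theorem norm_apply (hA : LocalOff S A) (φ : QReg ι) : ‖A φ‖ = ‖φ‖ := by
  induction hA generalizing φ with
  | id => rfl
  | comp _ _ _ ih => exact (ih _).trans (QGate.norm_apply _ φ)

theorem zeroProj_comm (hA : LocalOff S A) {k : ι} (hk : k ∈ S) (φ : QReg ι) :
    zeroProj k (A φ) = A (zeroProj k φ) := by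
  induction hA generalizing φ with
  | id => rfl
  | @comp _ _ i hi u ih =>
    have hne : i ≠ k := fun h => hi (h.symm ▸ hk)
    rw [LinearMap.comp_apply, ih, zeroProj_one hne]
    rfl

theorem norm_zeroProj (hA : LocalOff S A) {k : ι} (hk : k ∈ S) (φ : QReg ι) :
    ‖zeroProj k (A φ)‖ = ‖zeroProj k φ‖ := by
  rw [hA.zeroProj_comm hk, hA.norm_apply]

/-- One-qubit gates on `i` or `j` are absorbed into the matrix of the two-qubit gate; all others
commute past it. -/
theorem two_comp (hA : LocalOff ∅ A) {i j : ι} (hij : i ≠ j)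
    (u : Matrix.unitaryGroup (Fin 2 × Fin 2) ℂ) :
    ∃ B, LocalOff {i, j} B ∧ ∃ w, (QGate.two i j hij u).apply ∘ₗ A =
      B ∘ₗ (QGate.two i j hij w).apply := by
  induction hA with
  | id => exact ⟨_, LocalOff.id, u, rfl⟩
  | @comp A _ k _ v ih =>
    obtain ⟨B, hB, w, h⟩ := ih
    rw [← LinearMap.comp_assoc, h, LinearMap.comp_assoc]
    by_cases hi : k = i
    · subst hi
      obtain ⟨w', h'⟩ := QGate.two_one_left hij w v
      exact ⟨B, hB, w', by rw [h']⟩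
    by_cases hj : k = j
    · subst hj
      obtain ⟨w', h'⟩ := QGate.two_one_right hij w v
      exact ⟨B, hB, w', by rw [h']⟩
    · refine ⟨B ∘ₗ (QGate.one k v).apply, hB.comp (by simp [hi, hj]) v, w, ?_⟩
      rw [QGate.one_two_comm hij (Ne.symm hi) (Ne.symm hj), LinearMap.comp_assoc]

theorem exists_eq_comp_one (hA : LocalOff ∅ A) (k : ι) :
    ∃ B, LocalOff {k} B ∧ ∃ u, A = B ∘ₗ (QGate.one k u).apply := by
  induction hA with
  | id =>
    refine ⟨_, LocalOff.id, 1, ?_⟩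
    ext φ x
    simp [QGate.one_apply, Matrix.one_apply]
  | @comp A _ i _ v ih =>
    obtain ⟨B, hB, u, h⟩ := ih
    rw [h, LinearMap.comp_assoc]
    by_cases hi : i = k
    · subst hi
      exact ⟨B, hB, _, by rw [QGate.one_one]⟩
    · refine ⟨B ∘ₗ (QGate.one i v).apply, hB.comp (by simpa using hi) v, u, ?_⟩
      rw [QGate.one_comm (Ne.symm hi), LinearMap.comp_assoc]

end LocalOff

/-- A two-qubit gate together with the pair of qubits it acts on. -/
abbrev TwoGate (ι : Type) : Type :=
  {p : ι × ι // p.1 ≠ p.2} × Matrix.unitaryGroup (Fin 2 × Fin 2) ℂ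

/-- A two-qubit gate as a gate. -/
def TwoGate.toGate {ι : Type} (g : TwoGate ι) : QGate ι := QGate.two g.1.1.1 g.1.1.2 g.1.2 g.2

/-- The operator implemented by a sequence of two-qubit gates. -/
def twoApply (L : List (TwoGate ι)) : QReg ι →ₗ[ℂ] QReg ι := QCircuit.apply (L.map TwoGate.toGate)

theorem twoApply_cons (g : TwoGate ι) (L : List (TwoGate ι)) (φ : QReg ι) :
    twoApply (g :: L) φ = twoApply L (g.toGate.apply φ) := rfl

theorem twoApply_append (L L' : List (TwoGate ι)) :
    twoApply (L ++ L') = twoApply L' ∘ₗ twoApply L := by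
  rw [twoApply, List.map_append, QCircuit.apply_append]
  rfl

theorem norm_twoApply (L : List (TwoGate ι)) (φ : QReg ι) : ‖twoApply L φ‖ = ‖φ‖ :=
  QCircuit.norm_apply _ φ

/-- One-qubit gates are free and unbounded in number, so they must go before circuits can be
counted: each two-qubit gate absorbs those preceding it on its qubits, and the rest move to the end.
-/
theorem exists_twoGate_normalForm (W : QCircuit ι) :
    ∃ L : List (TwoGate ι), L.length = QCircuit.twoQubitGates W ∧
      ∃ A, LocalOff ∅ A ∧ QCircuit.apply W = A ∘ₗ twoApply L := by
  induction W using List.reverseRecOn with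
  | nil => exact ⟨[], rfl, _, LocalOff.id, rfl⟩
  | append_singleton W g ih =>
    obtain ⟨L, hL, A, hA, h⟩ := ih
    rw [QCircuit.apply_append, h, ← LinearMap.comp_assoc]
    cases g with
    | one i u =>
      refine ⟨L, ?_, _, hA.one_comp (Set.notMem_empty i) u, rfl⟩
      simp [hL, QCircuit.twoQubitGates, QGate.isTwo, List.countP_append]
    | two i j hij u =>
      obtain ⟨B, hB, w, hw⟩ := hA.two_comp hij u
      refine ⟨L ++ [⟨⟨(i, j), hij⟩, w⟩], ?_, B, hB.mono (Set.empty_subset _), ?_⟩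
      · simp [hL, QCircuit.twoQubitGates, QGate.isTwo, List.countP_append]
      · rw [twoApply_append, ← LinearMap.comp_assoc]
        exact congrArg (· ∘ₗ twoApply L) hw

/-- An extra identity gate on the measured qubit and `j` absorbs the final one-qubit gates there, at
the cost of the + 1. The gates left over act elsewhere and do not change the outcome probability. -/
theorem exists_twoGate_measurement (W : QCircuit ι) {i j : ι} (hij : i ≠ j) :
    ∃ L : List (TwoGate ι), L.length = QCircuit.twoQubitGates W + 1 ∧
      ∀ φ, ‖zeroProj i (QCircuit.apply W φ)‖ = ‖zeroProj i (twoApply L φ)‖ := by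
  obtain ⟨L, hL, A, hA, h⟩ := exists_twoGate_normalForm W
  obtain ⟨B, hB, w, hw⟩ := hA.two_comp hij 1
  rw [QGate.two_id, LinearMap.id_comp] at hw
  refine ⟨L ++ [⟨⟨(i, j), hij⟩, w⟩], by simp [hL], fun φ => ?_⟩
  rw [h, hw, twoApply_append]
  exact hB.norm_zeroProj (Set.mem_insert i {j}) _

end Circuits
end

noncomputable section

/-! ### Relabelling qubits -/

section Relabel

open Finset

variable {ι κ ν : Type} [Fintype ι] [DecidableEq ι] [Fintype κ] [DecidableEq κ] [Fintype ν]
  [DecidableEq ν]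

open Classical in
/-- The state of the register `κ` in which the qubits labelled by `e` are in the state `φ` and all
others are `|0⟩`. -/
def embedState (e : ι ↪ κ) (φ : QReg ι) : QReg κ :=
  WithLp.toLp 2 fun x => if ∀ k, k ∉ Set.range e → x k = 0 then φ (x ∘ e) else 0

open Classical in
theorem embedState_apply (e : ι ↪ κ) (φ : QReg ι) (x : κ → Fin 2) :
    embedState e φ x = if ∀ k, k ∉ Set.range e → x k = 0 then φ (x ∘ e) else 0 := rfl

theorem embedState_trans (e : ι ↪ κ) (f : κ ↪ ν) (φ : QReg ι) :
    embedState f (embedState e φ) = embedState (e.trans f) φ := by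
  ext x
  simp only [embedState_apply]
  have h : (∀ k, k ∉ Set.range (e.trans f) → x k = 0) ↔
      (∀ k, k ∉ Set.range f → x k = 0) ∧ ∀ k, k ∉ Set.range e → (x ∘ f) k = 0 := by
    constructor
    · refine fun h => ⟨fun k hk => h k ?_, fun k hk => h (f k) ?_⟩
      · rintro ⟨i, rfl⟩
        exact hk ⟨e i, rfl⟩
      · rintro ⟨i, hi⟩
        exact hk ⟨i, f.injective hi⟩
    · rintro ⟨h1, h2⟩ k hk
      by_cases hf : k ∈ Set.range f
      · obtain ⟨j, rfl⟩ := hf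
        refine h2 j ?_
        rintro ⟨i, rfl⟩
        exact hk ⟨i, rfl⟩
      · exact h1 k hf
  by_cases h1 : ∀ k, k ∉ Set.range f → x k = 0
  · by_cases h2 : ∀ k, k ∉ Set.range e → (x ∘ f) k = 0
    · rw [if_pos h1, if_pos h2, if_pos (h.2 ⟨h1, h2⟩)]
      rfl
    · rw [if_pos h1, if_neg h2, if_neg fun h3 => h2 (h.1 h3).2]
  · rw [if_neg h1, if_neg fun h3 => h1 (h.1 h3).1]

theorem norm_embedState (e : ι ↪ κ) (φ : QReg ι) : ‖embedState e φ‖ = ‖φ‖ := by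
  refine (sq_eq_sq₀ (norm_nonneg _) (norm_nonneg _)).1 ?_
  rw [EuclideanSpace.norm_sq_eq, EuclideanSpace.norm_sq_eq]
  symm
  refine Fintype.sum_of_injective (fun y : ι → Fin 2 => Function.extend e y 0) ?_ _ _ ?_ ?_
  · intro y z h
    funext i
    have := congrFun h (e i)
    simpa [e.injective.extend_apply] using this
  · intro x hx
    rw [embedState_apply, if_neg]
    · simp
    · intro h
      refine hx ⟨x ∘ e, ?_⟩
      funext k
      by_cases hk : k ∈ Set.range e
      · obtain ⟨i, rfl⟩ := hk
        exact e.injective.extend_apply _ _ i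
      · simp only
        rw [Function.extend_apply' _ _ _ hk, h k hk]
        rfl
  · intro y
    rw [embedState_apply, if_pos]
    · have h : Function.extend e y 0 ∘ e = y := funext fun i => e.injective.extend_apply _ _ i
      rw [h]
    · intro k hk
      exact Function.extend_apply' _ _ _ hk

omit [Fintype ι] [Fintype κ] in
theorem update_comp_embedding (e : ι ↪ κ) (x : κ → Fin 2) (i : ι) (a : Fin 2) :
    Function.update x (e i) a ∘ e = Function.update (x ∘ e) i a :=
  Function.update_comp_eq_of_injective x e.injective i a

omit [Fintype ι] [DecidableEq ι] [Fintype κ] in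
theorem update_embedding_eq_zero_iff (e : ι ↪ κ) (x : κ → Fin 2) (i : ι) (a : Fin 2) :
    (∀ k, k ∉ Set.range e → Function.update x (e i) a k = 0) ↔
      ∀ k, k ∉ Set.range e → x k = 0 := by
  refine forall₂_congr fun k hk => ?_
  rw [Function.update_of_ne]
  rintro rfl
  exact hk ⟨i, rfl⟩

theorem one_apply_embedState (e : ι ↪ κ) (i : ι) (u : Matrix.unitaryGroup (Fin 2) ℂ) (φ : QReg ι) :
    (QGate.one (e i) u).apply (embedState e φ) = embedState e ((QGate.one i u).apply φ) := by
  ext x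
  simp only [QGate.one_apply, embedState_apply, update_embedding_eq_zero_iff,
    update_comp_embedding]
  split_ifs <;> simp

theorem two_apply_embedState (e : ι ↪ κ) {i j : ι} (hij : i ≠ j) (hij' : e i ≠ e j)
    (u : Matrix.unitaryGroup (Fin 2 × Fin 2) ℂ) (φ : QReg ι) :
    (QGate.two (e i) (e j) hij' u).apply (embedState e φ) =
      embedState e ((QGate.two i j hij u).apply φ) := by
  ext x
  simp only [QGate.two_apply, embedState_apply, update_embedding_eq_zero_iff,
    update_comp_embedding]
  split_ifs <;> simp

theorem zeroProj_embedState (e : ι ↪ κ) (i : ι) (φ : QReg ι) :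
    zeroProj (e i) (embedState e φ) = embedState e (zeroProj i φ) := by
  ext x
  simp only [zeroProj_apply, embedState_apply, Function.comp_apply]
  split_ifs <;> rfl

/-- The same gate on relabelled qubits. -/
def TwoGate.relabel {ι κ : Type} (e : ι ↪ κ) (g : TwoGate ι) : TwoGate κ :=
  ⟨⟨(e g.1.1.1, e g.1.1.2), e.injective.ne g.1.2⟩, g.2⟩

theorem twoApply_relabel (e : ι ↪ κ) (L : List (TwoGate ι)) (φ : QReg ι) :
    twoApply (L.map (TwoGate.relabel e)) (embedState e φ) = embedState e (twoApply L φ) := by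
  induction L generalizing φ with
  | nil => rfl
  | cons g L ih =>
    rw [List.map_cons, twoApply_cons, twoApply_cons, ← ih]
    congr 1
    exact two_apply_embedState e g.1.2 _ g.2 φ

theorem withAncilla_eq_embedState (a : ℕ) {N : ℕ} (φ : QReg (Fin N)) :
    withAncilla a φ = embedState Function.Embedding.inr φ := by
  ext x
  rw [embedState_apply]
  have h : (∀ k : Fin a, x (Sum.inl k) = 0) ↔
      ∀ k, k ∉ Set.range (Function.Embedding.inr : Fin N ↪ Fin a ⊕ Fin N) → x k = 0 := by
    constructor
    · rintro h (k | k) hk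
      · exact h k
      · exact absurd ⟨k, rfl⟩ hk
    · intro h k
      exact h _ (by rintro ⟨i, hi⟩; cases hi)
  change (if ∀ k : Fin a, x (Sum.inl k) = 0 then φ (fun j => x (Sum.inr j)) else 0) = _
  simp only [h]
  split_ifs <;> rfl

theorem norm_withAncilla (a : ℕ) {N : ℕ} (φ : QReg (Fin N)) : ‖withAncilla a φ‖ = ‖φ‖ := by
  rw [withAncilla_eq_embedState, norm_embedState]

/-- Relabelling the ancillas. -/
def ancillaEmbedding {a b : ℕ} (N : ℕ) (f : Fin a ↪ Fin b) : Fin a ⊕ Fin N ↪ Fin b ⊕ Fin N :=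
  f.sumMap (Function.Embedding.refl _)

theorem norm_zeroProj_relabel {a b N : ℕ} (f : Fin a ↪ Fin b)
    (L : List (TwoGate (Fin a ⊕ Fin N))) (i : Fin N) (φ : QReg (Fin N)) :
    ‖zeroProj (Sum.inr i) (twoApply (L.map (TwoGate.relabel (ancillaEmbedding N f)))
      (withAncilla b φ))‖ = ‖zeroProj (Sum.inr i) (twoApply L (withAncilla a φ))‖ := by
  have h : withAncilla b φ = embedState (ancillaEmbedding N f) (withAncilla a φ) := by
    rw [withAncilla_eq_embedState, withAncilla_eq_embedState, embedState_trans]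
    rfl
  rw [h, twoApply_relabel]
  exact (congrArg norm (zeroProj_embedState (ancillaEmbedding N f) (Sum.inr i) _)).trans
    (norm_embedState _ _)

/-- A sequence of `R` two-qubit gates can be run with `2 R` ancillas. -/
theorem exists_relabel {a N : ℕ} (i : Fin N) (L : List (TwoGate (Fin a ⊕ Fin N))) :
    ∃ L' : List (TwoGate (Fin (2 * L.length) ⊕ Fin N)), L'.length = L.length ∧
      ∀ φ, ‖zeroProj (Sum.inr i) (twoApply L' (withAncilla _ φ))‖ =
        ‖zeroProj (Sum.inr i) (twoApply L (withAncilla a φ))‖ := by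
  set R := L.length with hR
  -- Adding 2R spare ancillas guarantees that the touched ancillas, at most 2R, extend to a set of
  -- exactly 2R.
  let L₁ := L.map (TwoGate.relabel (ancillaEmbedding N (Fin.castAddEmb (n := a) (2 * R))))
  let S : Finset (Fin (a + 2 * R) ⊕ Fin N) :=
    (L₁.map fun g => g.1.1.1).toFinset ∪ (L₁.map fun g => g.1.1.2).toFinset
  have hS : S.toLeft.card ≤ 2 * R := by
    refine card_toLeft_le.trans ((card_union_le _ _).trans ?_)
    have h1 := (L₁.map fun g => g.1.1.1).toFinset_card_le
    have h2 := (L₁.map fun g => g.1.1.2).toFinset_card_le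
    have h3 : L₁.length = R := List.length_map _
    rw [List.length_map, h3] at h1 h2
    omega
  obtain ⟨S', hS', hcard⟩ := exists_superset_card_eq hS (by simp)
  let f : Fin (2 * R) ↪ Fin (a + 2 * R) := (S'.orderEmbOfFin hcard).toEmbedding
  have hf : ∀ k, k ∈ S → k ∈ Set.range (ancillaEmbedding N f) := by
    rintro (k | k) hk
    · have : k ∈ Set.range (S'.orderEmbOfFin hcard) := by
        rw [range_orderEmbOfFin]
        exact hS' (mem_toLeft.2 hk)
      obtain ⟨j, rfl⟩ := this
      exact ⟨Sum.inl j, rfl⟩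
    · exact ⟨Sum.inr k, rfl⟩
  have hmem : ∀ g ∈ L₁, g ∈ Set.range (TwoGate.relabel (ancillaEmbedding N f)) := by
    intro g hg
    obtain ⟨i, hi⟩ := hf g.1.1.1 (mem_union_left _ (List.mem_toFinset.2 (List.mem_map.2 ⟨g, hg, rfl⟩)))
    obtain ⟨j, hj⟩ := hf g.1.1.2 (mem_union_right _ (List.mem_toFinset.2 (List.mem_map.2 ⟨g, hg, rfl⟩)))
    refine ⟨⟨⟨(i, j), ?_⟩, g.2⟩, ?_⟩
    · intro h
      exact g.1.2 (hi.symm.trans ((congrArg _ h).trans hj))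
    · exact Prod.ext (Subtype.ext (Prod.ext hi hj)) rfl
  obtain ⟨L', hL'⟩ : ∃ L' : List _, L'.map (TwoGate.relabel (ancillaEmbedding N f)) = L₁ := by
    have : L₁ ∈ {l : List _ | ∀ x ∈ l, x ∈ Set.range (TwoGate.relabel (ancillaEmbedding N f))} := hmem
    rwa [← Set.range_list_map] at this
  refine ⟨L', ?_, fun φ => ?_⟩
  · have := congrArg List.length hL'
    simpa [L₁] using this
  · rw [← norm_zeroProj_relabel f L', hL', norm_zeroProj_relabel]

/-- A circuit without two-qubit gates can be made to output `0` with certainty. -/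
theorem exists_norm_zeroProj_eq_one {a N : ℕ} (i : Fin N) (W : QCircuit (Fin a ⊕ Fin N))
    (hW : QCircuit.twoQubitGates W = 0) :
    ∃ φ : QReg (Fin N), ‖φ‖ = 1 ∧
      ‖zeroProj (Sum.inr i) (QCircuit.apply W (withAncilla a φ))‖ = 1 := by
  obtain ⟨L, hL, A, hA, h⟩ := exists_twoGate_normalForm W
  rw [hW, List.length_eq_zero_iff] at hL
  subst hL
  obtain ⟨B, hB, u, rfl⟩ := hA.exists_eq_comp_one (Sum.inr i)
  let φ₀ : QReg (Fin N) := EuclideanSpace.single 0 1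
  have hφ₀ : zeroProj i φ₀ = φ₀ := by
    ext x
    rw [zeroProj_apply]
    split_ifs with hx
    · rfl
    · have : x ≠ 0 := fun h0 => hx (by rw [h0]; rfl)
      simp [φ₀, this]
  have hnorm : ‖φ₀‖ = 1 := by simp [φ₀]
  -- The input undoes in advance the only gate that reaches the measured qubit.
  refine ⟨(QGate.one i u⁻¹).apply φ₀, by rw [QGate.norm_apply, hnorm], ?_⟩
  have h1 : (QGate.one (Sum.inr i) u).apply (withAncilla a ((QGate.one i u⁻¹).apply φ₀)) =
      withAncilla a φ₀ := by
    rw [withAncilla_eq_embedState, withAncilla_eq_embedState]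
    refine (one_apply_embedState Function.Embedding.inr i u _).trans (congrArg _ ?_)
    rw [← LinearMap.comp_apply, QGate.one_one, mul_inv_cancel]
    ext x
    simp [QGate.one_apply, Matrix.one_apply]
  rw [h]
  change ‖zeroProj (Sum.inr i) (B ((QGate.one (Sum.inr i) u).apply _))‖ = 1
  rw [hB.norm_zeroProj (Set.mem_singleton _)]
  have h2 : twoApply [] (withAncilla a ((QGate.one i u⁻¹).apply φ₀)) =
    withAncilla a ((QGate.one i u⁻¹).apply φ₀) := rfl
  rw [h2, h1, withAncilla_eq_embedState]
  refine (congrArg norm (zeroProj_embedState Function.Embedding.inr i φ₀)).trans ?_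
  rw [norm_embedState, hφ₀, hnorm]

end Relabel
end

noncomputable section

/-! ### Counting circuits -/

section Counting

open Finset

/-- The index of the cell of width `1 / m` of `[-1, 1]` which contains `z`. -/
def cell (m : ℕ) (z : ℝ) : Fin (2 * m + 1) :=
  ⟨min (⌊m * z⌋ + m).toNat (2 * m), Nat.lt_succ_of_le (min_le_right _ _)⟩

theorem abs_sub_le_of_cell_eq {m : ℕ} (hm : 0 < m) {z w : ℝ} (hz : |z| ≤ 1) (hw : |w| ≤ 1)
    (h : cell m z = cell m w) : |z - w| ≤ 1 / m := by
  have hm' : (0 : ℝ) < m := by exact_mod_cast hm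
  have hb : ∀ t : ℝ, |t| ≤ 1 → 0 ≤ ⌊m * t⌋ + m ∧ ⌊m * t⌋ + m ≤ 2 * m := by
    intro t ht
    obtain ⟨h1, h2⟩ := abs_le.1 ht
    constructor
    · have : -(m : ℤ) ≤ ⌊m * t⌋ := Int.le_floor.2 (by push_cast; nlinarith)
      linarith
    · have : (⌊m * t⌋ : ℝ) ≤ m := (Int.floor_le _).trans (by nlinarith)
      have : ⌊m * t⌋ ≤ (m : ℤ) := by exact_mod_cast this
      linarith
  have h1 := congrArg Fin.val h
  simp only [cell] at h1
  have hz' := hb z hz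
  have hw' := hb w hw
  have h2 : ⌊m * z⌋ = ⌊m * w⌋ := by omega
  have h3 := Int.abs_sub_lt_one_of_floor_eq_floor h2
  rw [← mul_sub, abs_mul, abs_of_pos hm'] at h3
  rw [le_div_iff₀ hm']
  linarith

variable {κ : Type} [Fintype κ] [DecidableEq κ]

/-- The qubits a gate acts on, and the cells of the entries of its matrix. -/
def gateCode (m : ℕ) (g : TwoGate κ) : (κ × κ) × (Fin 2 × Fin 2 → Fin 2 × Fin 2 →
    Fin (2 * m + 1) × Fin (2 * m + 1)) :=
  (g.1.1, fun q p => (cell m ((g.2 : Matrix (Fin 2 × Fin 2) (Fin 2 × Fin 2) ℂ) q p).re,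
    cell m ((g.2 : Matrix (Fin 2 × Fin 2) (Fin 2 × Fin 2) ℂ) q p).im))

theorem norm_toGate_sub_le {m : ℕ} (hm : 0 < m) {g g' : TwoGate κ}
    (h : gateCode m g = gateCode m g') (φ : QReg κ) :
    ‖g.toGate.apply φ - g'.toGate.apply φ‖ ≤ 8 / m * ‖φ‖ := by
  obtain ⟨⟨p, hp⟩, u⟩ := g
  obtain ⟨⟨p', hp'⟩, v⟩ := g'
  simp only [gateCode, Prod.mk.injEq] at h
  obtain ⟨rfl, h⟩ := h
  have hδ : ∀ q p, ‖(u : Matrix (Fin 2 × Fin 2) (Fin 2 × Fin 2) ℂ) q p - v q p‖ ≤ 2 / m := by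
    intro q p
    have h1 := congrFun (congrFun h q) p
    simp only [Prod.mk.injEq] at h1
    have hu := entry_norm_bound_of_unitary u.2 q p
    have hv := entry_norm_bound_of_unitary v.2 q p
    have hre := abs_sub_le_of_cell_eq hm ((Complex.abs_re_le_norm _).trans hu)
      ((Complex.abs_re_le_norm _).trans hv) h1.1
    have him := abs_sub_le_of_cell_eq hm ((Complex.abs_im_le_norm _).trans hu)
      ((Complex.abs_im_le_norm _).trans hv) h1.2
    refine (Complex.norm_le_abs_re_add_abs_im _).trans ?_
    rw [Complex.sub_re, Complex.sub_im]
    refine (add_le_add hre him).trans (le_of_eq ?_)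
    ring
  refine (QGate.norm_two_sub_two_le hp (by positivity) hδ φ).trans (le_of_eq ?_)
  ring

theorem norm_twoApply_sub_le {m : ℕ} (hm : 0 < m) (L L' : List (TwoGate κ))
    (h : L.map (gateCode m) = L'.map (gateCode m)) (φ : QReg κ) :
    ‖twoApply L φ - twoApply L' φ‖ ≤ L.length * (8 / m) * ‖φ‖ := by
  induction L generalizing L' φ with
  | nil =>
    obtain rfl : L' = [] := by simpa using h.symm
    simp
  | cons g L ih =>
    cases L' with
    | nil => simp at h
    | cons g' L' =>
      rw [List.map_cons, List.map_cons, List.cons.injEq] at h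
      rw [twoApply_cons, twoApply_cons]
      have h1 := norm_toGate_sub_le hm h.1 φ
      have h2 := ih L' h.2 (g'.toGate.apply φ)
      rw [QGate.norm_apply] at h2
      rw [← norm_twoApply L, map_sub] at h1
      refine (norm_sub_le_norm_sub_add_norm_sub _ (twoApply L (g'.toGate.apply φ)) _).trans ?_
      refine (add_le_add h1 h2).trans (le_of_eq ?_)
      rw [List.length_cons]
      push_cast
      ring

theorem abs_norm_zeroProj_sq_sub_le (i : κ) {ψ χ : QReg κ} (hψ : ‖ψ‖ = 1) (hχ : ‖χ‖ = 1) :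
    |‖zeroProj i ψ‖ ^ 2 - ‖zeroProj i χ‖ ^ 2| ≤ 2 * ‖ψ - χ‖ := by
  have h1 : |‖zeroProj i ψ‖ - ‖zeroProj i χ‖| ≤ ‖ψ - χ‖ := by
    refine (abs_norm_sub_norm_le _ _).trans ?_
    rw [← map_sub]
    exact norm_zeroProj_le i _
  have h2 := norm_zeroProj_le i ψ
  have h3 := norm_zeroProj_le i χ
  have h4 : |‖zeroProj i ψ‖ + ‖zeroProj i χ‖| ≤ 2 := by
    rw [abs_of_nonneg (by positivity)]
    linarith
  rw [sq_sub_sq, abs_mul]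
  gcongr

/-- A family of sequences of `R` two-qubit gates which are pairwise distinguished by a measurement
on some input has at most exponentially many members. -/
theorem card_le_of_distinguished {B : Type} [Fintype B] {R : ℕ} (hR : 0 < R) (i : κ)
    (L : B → List (TwoGate κ)) (hL : ∀ f, (L f).length = R)
    (hsep : ∀ f f', f ≠ f' → ∃ ψ : QReg κ, ‖ψ‖ = 1 ∧
      0.7 ≤ |‖zeroProj i (twoApply (L f) ψ)‖ ^ 2 - ‖zeroProj i (twoApply (L f') ψ)‖ ^ 2|) :
    Fintype.card B ≤ (Fintype.card κ ^ 2 * (64 * R + 1) ^ 32) ^ R := by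
  classical
  -- With mesh 1/(32R) each gate is determined up to 8/(32R) in norm, hence the circuit up to 1/4
  -- and the probability up to 1/2 < 0.7. The exponent 32 counts the real and imaginary parts of 16
  -- entries.
  let code : B → List.Vector ((κ × κ) × (Fin 2 × Fin 2 → Fin 2 × Fin 2 →
    Fin (2 * (32 * R) + 1) × Fin (2 * (32 * R) + 1))) R :=
    fun f => ⟨(L f).map (gateCode (32 * R)), by rw [List.length_map, hL]⟩
  have hinj : Function.Injective code := by
    intro f f' h
    by_contra hne
    obtain ⟨ψ, hψ, hgap⟩ := hsep f f' hne
    have h1 := norm_twoApply_sub_le (m := 32 * R) (by positivity) (L f) (L f')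
      (congrArg Subtype.val h) ψ
    have h2 := abs_norm_zeroProj_sq_sub_le i ((norm_twoApply (L f) ψ).trans hψ)
      ((norm_twoApply (L f') ψ).trans hψ)
    have h3 : ((L f).length : ℝ) * (8 / ((32 * R : ℕ) : ℝ)) * ‖ψ‖ = 1 / 4 := by
      rw [hL, hψ]
      push_cast
      field_simp
      norm_num
    rw [h3] at h1
    norm_num at hgap
    linarith
  refine (Fintype.card_le_of_injective code hinj).trans (le_of_eq ?_)
  rw [card_vector]
  simp only [Fintype.card_prod, Fintype.card_fun, Fintype.card_fin]
  ring_nf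

/-- Counting needs one common register and one common length. The strict inequality leaves room for
the extra measurement gate, and identity gates pad the rest. -/
theorem exists_twoGates {a N R : ℕ} {i j : Fin N} (hij : i ≠ j) (W : QCircuit (Fin a ⊕ Fin N))
    (hW : QCircuit.twoQubitGates W < R) :
    ∃ L : List (TwoGate (Fin (2 * R) ⊕ Fin N)), L.length = R ∧
      ∀ φ, ‖zeroProj (Sum.inr i) (twoApply L (withAncilla _ φ))‖ =
        ‖zeroProj (Sum.inr i) (QCircuit.apply W (withAncilla a φ))‖ := by
  have hij' : (Sum.inr i : Fin a ⊕ Fin N) ≠ Sum.inr j := Sum.inr_injective.ne hij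
  obtain ⟨L₀, hlen, hL₀⟩ := exists_twoGate_measurement W hij'
  have hid : ∀ (n : ℕ) (φ : QReg (Fin a ⊕ Fin N)),
      twoApply (List.replicate n ⟨⟨(Sum.inr i, Sum.inr j), hij'⟩, 1⟩) φ = φ := by
    intro n φ
    induction n with
    | zero => rfl
    | succ n ih =>
      rw [List.replicate_succ, twoApply_cons]
      refine Eq.trans ?_ ih
      exact congrArg _ (congrArg (· φ) (QGate.two_id hij'))
  obtain ⟨L, hL⟩ : ∃ L : List (TwoGate (Fin a ⊕ Fin N)), L.length = R ∧
      ∀ φ, twoApply L φ = twoApply L₀ φ := by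
    refine ⟨L₀ ++ List.replicate (R - L₀.length) ⟨⟨(Sum.inr i, Sum.inr j), hij'⟩, 1⟩, ?_, ?_⟩
    · rw [List.length_append, List.length_replicate]
      omega
    · intro φ
      rw [twoApply_append, LinearMap.comp_apply, hid]
  obtain ⟨rfl, hL⟩ := hL
  obtain ⟨L', hlen', hL'⟩ := exists_relabel i L
  exact ⟨L', hlen', fun φ => by rw [hL', hL, hL₀]⟩

end Counting

/-! ### The hard Hamiltonian -/

section Hard

open Finset

variable {N : ℕ}

/-- The permutation `x ↦ x ⊕ f` of the basis states, where `f` is added to the qubit `i` and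
depends on the other qubits. -/
def flipPerm (i : Fin N) (f : ({j : Fin N // j ≠ i} → Fin 2) → Fin 2) :
    Equiv.Perm (Fin N → Fin 2) :=
  Function.Involutive.toPerm (fun x => Function.update x i (x i + f fun j => x j)) fun x => by
    have h1 : (fun j : {j : Fin N // j ≠ i} =>
        Function.update x i (x i + f fun j => x j) (j : Fin N)) =
        fun j : {j : Fin N // j ≠ i} => x j :=
      funext fun j => Function.update_of_ne j.2 _ _
    have h2 : ∀ a b : Fin 2, a + b + b = a := by decide
    simp only [h1, Function.update_self, Function.update_idem, h2, Function.update_eq_self]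

theorem flipPerm_apply (i : Fin N) (f : ({j : Fin N // j ≠ i} → Fin 2) → Fin 2)
    (x : Fin N → Fin 2) : flipPerm i f x = Function.update x i (x i + f fun j => x j) := rfl

/-- The unitary `|x⟩ ↦ |x ⊕ f⟩`. -/
def flipUnitary (i : Fin N) (f : ({j : Fin N // j ≠ i} → Fin 2) → Fin 2) :
    QReg (Fin N) ≃ₗᵢ[ℂ] QReg (Fin N) :=
  LinearIsometryEquiv.piLpCongrLeft 2 ℂ ℂ (flipPerm i f)

theorem flipUnitary_apply (i : Fin N) (f : ({j : Fin N // j ≠ i} → Fin 2) → Fin 2)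
    (φ : QReg (Fin N)) (x : Fin N → Fin 2) : flipUnitary i f φ x = φ (flipPerm i f x) := rfl

theorem flipUnitary_zero (i : Fin N) (φ : QReg (Fin N)) : flipUnitary i 0 φ = φ := by
  ext x
  rw [flipUnitary_apply, flipPerm_apply]
  simp

theorem flipUnitary_single (i : Fin N) (f : ({j : Fin N // j ≠ i} → Fin 2) → Fin 2)
    (x : Fin N → Fin 2) :
    flipUnitary i f (EuclideanSpace.single x 1) = EuclideanSpace.single (flipPerm i f x) 1 :=
  LinearIsometryEquiv.piLpCongrLeft_single _ _ _

theorem norm_zeroProj_single_sq (i : Fin N) (x : Fin N → Fin 2) :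
    ‖zeroProj i (EuclideanSpace.single x (1 : ℂ))‖ ^ 2 = if x i = 0 then 1 else 0 := by
  split_ifs with h
  · have : zeroProj i (EuclideanSpace.single x (1 : ℂ)) = EuclideanSpace.single x (1 : ℂ) := by
      ext y
      rw [zeroProj_apply]
      split_ifs with hy
      · rfl
      · have : y ≠ x := fun e => hy (e ▸ h)
        simp [this]
    rw [this]
    simp
  · have : zeroProj i (EuclideanSpace.single x (1 : ℂ)) = 0 := by
      ext y
      rw [zeroProj_apply]
      split_ifs with hy
      · have : y ≠ x := fun e => h (e ▸ hy)
        simp [this]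
      · rfl
    rw [this]
    simp

theorem norm_zeroProj_flip_one_sq (i : Fin N) (φ : QReg (Fin N)) :
    ‖zeroProj i (flipUnitary i 1 φ)‖ ^ 2 = ‖φ‖ ^ 2 - ‖zeroProj i φ‖ ^ 2 := by
  have h0 : ‖zeroProj i (flipUnitary i 1 φ)‖ ^ 2 =
      ∑ x : Fin N → Fin 2, if x i = 0 then 0 else ‖φ x‖ ^ 2 := by
    rw [EuclideanSpace.norm_sq_eq, ← Equiv.sum_comp (flipPerm i 1)]
    refine sum_congr rfl fun x _ => ?_
    have hinv : flipPerm i 1 (flipPerm i 1 x) = x := (flipPerm i 1).symm_apply_apply x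
    rw [zeroProj_apply, flipUnitary_apply, hinv, flipPerm_apply, Function.update_self]
    have h2 : ∀ a : Fin 2, a + 1 = 0 ↔ ¬ a = 0 := by decide
    simp only [Pi.one_apply, h2]
    split_ifs <;> simp
  rw [h0, eq_sub_iff_add_eq, EuclideanSpace.norm_sq_eq, EuclideanSpace.norm_sq_eq,
    ← sum_add_distrib]
  refine sum_congr rfl fun x _ => ?_
  rw [zeroProj_apply]
  split_ifs <;> simp

/-- At z = 1 this is the total mass of the Poisson law; at z = -1 it is the bias of the parity of
the boson number. -/
theorem hasSum_poisson (t z : ℝ) :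
    HasSum (fun n : ℕ => Real.exp (-t ^ 2) * ((t ^ 2) ^ n / (n.factorial : ℝ)) * z ^ n)
      (Real.exp (t ^ 2 * (z - 1))) := by
  have h := (NormedSpace.expSeries_div_hasSum_exp (t ^ 2 * z)).mul_left (Real.exp (-t ^ 2))
  rw [← Real.exp_eq_exp_ℝ, ← Real.exp_add] at h
  have e : -t ^ 2 + t ^ 2 * z = t ^ 2 * (z - 1) := by ring
  rw [e] at h
  refine h.congr_fun fun n => ?_
  rw [mul_pow]
  ring

/-- `W` reproduces the measurement statistics of the evolution `V` up to an error of `0.1`. -/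
def Simulates {a : ℕ} (i : Fin N) (V : BosonQubit N ≃ₗᵢ[ℂ] BosonQubit N)
    (W : QCircuit (Fin a ⊕ Fin N)) : Prop :=
  ∀ φ : QReg (Fin N), ‖φ‖ = 1 →
    ‖inner ℂ (V (fockState 0 φ)) (idTensor (zeroProj i) (V (fockState 0 φ)))
      - inner ℂ (QCircuit.apply W (withAncilla a φ))
          (zeroProj (Sum.inr i) (QCircuit.apply W (withAncilla a φ)))‖ ≤ 0.1

theorem exists_timeEvolution_flip (i : Fin N) (t : ℝ)
    (f : ℕ → ({j : Fin N // j ≠ i} → Fin 2) → Fin 2) (h0 : f 0 = 0) :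
    ∃ U : BosonQubit N ≃ₗᵢ[ℂ] BosonQubit N, NumberPreserving U ∧
      ∃ V : ℝ → (BosonQubit N ≃ₗᵢ[ℂ] BosonQubit N), IsTimeEvolution (hamiltonian U) V ∧
        ∀ (a : ℕ) (W : QCircuit (Fin a ⊕ Fin N)), Simulates i (V t) W →
          ∀ (φ : QReg (Fin N)) (v : ℝ), ‖φ‖ = 1 →
            HasSum (fun n : ℕ => Real.exp (-t ^ 2) * ((t ^ 2) ^ n / (n.factorial : ℝ)) *
              ‖zeroProj i (flipUnitary i (f n) φ)‖ ^ 2) v →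
            |v - ‖zeroProj (Sum.inr i) (QCircuit.apply W (withAncilla a φ))‖ ^ 2| ≤ 0.1 := by
  obtain ⟨U, hU, V, hV, h⟩ := exists_timeEvolution_poisson (fun n => flipUnitary i (f n))
    (by simp [h0, flipUnitary_zero])
  refine ⟨U, hU, V, hV, fun a W hW φ v hφ hv => ?_⟩
  have h1 := h t φ (zeroProj i)
  have h2 : inner ℂ (V t (fockState 0 φ)) (idTensor (zeroProj i) (V t (fockState 0 φ))) = (v : ℂ) := by
    refine h1.unique ((Complex.hasSum_ofReal.2 hv).congr_fun fun n => ?_)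
    rw [inner_zeroProj]
    push_cast
    rfl
  have h3 := hW φ hφ
  rw [h2, inner_zeroProj, ← Complex.ofReal_sub, Complex.norm_real, Real.norm_eq_abs] at h3
  exact h3

/-- For every `N` there is an evolution which circuits without two-qubit gates cannot simulate. -/
theorem exists_timeEvolution_pos (i : Fin N) {t : ℝ} (ht : 1 ≤ t) :
    ∃ U : BosonQubit N ≃ₗᵢ[ℂ] BosonQubit N, NumberPreserving U ∧
      ∃ V : ℝ → (BosonQubit N ≃ₗᵢ[ℂ] BosonQubit N), IsTimeEvolution (hamiltonian U) V ∧
        ∀ (a : ℕ) (W : QCircuit (Fin a ⊕ Fin N)), Simulates i (V t) W →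
          1 ≤ QCircuit.twoQubitGates W := by
  -- Flipping on odd boson numbers turns an initial probability s into 1/2 + (s - 1/2)e^{-2t²},
  -- which is at most 3/4 for every input and so misses 1 by more than 0.1.
  obtain ⟨U, hU, V, hV, h⟩ := exists_timeEvolution_flip i t
    (fun n => if Even n then 0 else 1) (by simp)
  refine ⟨U, hU, V, hV, fun a W hW => ?_⟩
  by_contra hlt
  obtain ⟨φ, hφ, hone⟩ := exists_norm_zeroProj_eq_one i W (by omega)
  set s := ‖zeroProj i φ‖ ^ 2 with hs
  have hs1 : s ≤ 1 := by
    have := norm_zeroProj_le i φ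
    rw [hφ] at this
    exact pow_le_one₀ (norm_nonneg _) this
  have hsum := ((hasSum_poisson t 1).mul_right (1 / 2)).add
    ((hasSum_poisson t (-1)).mul_right (s - 1 / 2))
  have h1 := h a W hW φ _ hφ (hsum.congr_fun fun n => ?_)
  · rw [hone] at h1
    have h2 := abs_le.1 h1
    have h3 : Real.exp (t ^ 2 * (-1 - 1)) ≤ 1 / 2 := by
      have h4 : Real.exp (t ^ 2 * (-1 - 1)) ≤ Real.exp (-1) :=
        Real.exp_le_exp.2 (by nlinarith)
      have h5 : Real.exp (-1) ≤ 1 / 2 := by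
        rw [Real.exp_neg, one_div]
        have := Real.add_one_le_exp (1 : ℝ)
        exact inv_anti₀ (by norm_num) (by linarith)
      exact h4.trans h5
    have h6 := Real.exp_pos (t ^ 2 * (-1 - 1))
    norm_num at h2
    norm_num at h3 h6
    nlinarith [h2.1]
  · by_cases hn : Even n
    · simp only [hn, if_true, flipUnitary_zero, hn.neg_one_pow, one_pow]
      rw [← hs]
      ring
    · simp only [hn, if_false, norm_zeroProj_flip_one_sq, hφ,
        (Nat.not_even_iff_odd.1 hn).neg_one_pow, one_pow]
      rw [← hs]
      ring

theorem mul_sq_le_two_pow {n : ℕ} (hn : 20 ≤ n) : 35 * n ^ 2 ≤ 2 ^ (n - 1) := by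
  induction n, hn using Nat.le_induction with
  | base => norm_num
  | succ n hn ih =>
    have h : 2 ^ (n + 1 - 1) = 2 * 2 ^ (n - 1) := by
      rw [← pow_succ']
      congr 1
      omega
    rw [h]
    nlinarith

/-- Each gate contributes 34 factors, 2 for its qubits and 32 for its matrix, each at most 65R ≤
2^N. The total 2^(34NR) stays below 2^(35NR), which is where 35 comes from. -/
theorem card_codes_lt {R : ℕ} (hN : 20 ≤ N) (hR : R = 2 ^ (N - 1) / (35 * N)) :
    0 < R ∧ ((2 * R + N) ^ 2 * (64 * R + 1) ^ 32) ^ R < 2 ^ 2 ^ (N - 1) := by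
  have hNR : N ≤ R := by
    rw [hR, Nat.le_div_iff_mul_le (by omega)]
    have := mul_sq_le_two_pow hN
    nlinarith
  have hR1 : 35 * N * R ≤ 2 ^ (N - 1) := by
    rw [hR]
    exact Nat.mul_div_le _ _
  have hR0 : 0 < R := by omega
  refine ⟨hR0, ?_⟩
  have h65 : 65 * R ≤ 2 ^ N := by
    have : 2 ^ N = 2 * 2 ^ (N - 1) := by
      rw [← pow_succ']
      congr 1
      omega
    nlinarith
  calc ((2 * R + N) ^ 2 * (64 * R + 1) ^ 32) ^ R
      ≤ ((65 * R) ^ 2 * (65 * R) ^ 32) ^ R := by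
        gcongr <;> omega
    _ = (65 * R) ^ (34 * R) := by rw [← pow_add, ← pow_mul]
    _ ≤ (2 ^ N) ^ (34 * R) := by gcongr
    _ = 2 ^ (34 * N * R) := by
        rw [← pow_mul]
        ring_nf
    _ < 2 ^ (35 * N * R) := by
        refine Nat.pow_lt_pow_right (by norm_num) ?_
        have : 0 < N * R := by positivity
        nlinarith
    _ ≤ 2 ^ 2 ^ (N - 1) := Nat.pow_le_pow_right (by norm_num) hR1

/-- For large `N` there is an evolution whose simulation needs exponentially many gates. -/
theorem exists_timeEvolution_hard (hN : 20 ≤ N) (i : Fin N) {t : ℝ} (ht : (N : ℝ) ≤ t ^ 2) :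
    ∃ U : BosonQubit N ≃ₗᵢ[ℂ] BosonQubit N, NumberPreserving U ∧
      ∃ V : ℝ → (BosonQubit N ≃ₗᵢ[ℂ] BosonQubit N), IsTimeEvolution (hamiltonian U) V ∧
        ∀ (a : ℕ) (W : QCircuit (Fin a ⊕ Fin N)), Simulates i (V t) W →
          2 ^ (N - 1) / (35 * N) ≤ QCircuit.twoQubitGates W := by
  set R := 2 ^ (N - 1) / (35 * N) with hR
  obtain ⟨hR0, hcard⟩ := card_codes_lt hN hR
  choose U hU V hV h using fun f : ({j : Fin N // j ≠ i} → Fin 2) → Fin 2 =>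
    exists_timeEvolution_flip i t (fun n => if n = 0 then 0 else f) (by simp)
  -- Otherwise each of the 2^(2^(N-1)) functions f has a simulating circuit with fewer than R
  -- two-qubit gates.
  by_contra hcon
  push Not at hcon
  choose a W hW hlt using fun f => hcon (U f) (hU f) (V f) (hV f)
  obtain ⟨j, hij⟩ : ∃ j : Fin N, i ≠ j := by
    have : Nontrivial (Fin N) := Fin.nontrivial_iff_two_le.2 (by omega)
    obtain ⟨j, hj⟩ := exists_ne i
    exact ⟨j, hj.symm⟩
  choose L hlen hL using fun f => exists_twoGates hij (W f) (hlt f)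
  -- This is the weight of the vacuum, the only sector where f is not applied. The circuit therefore
  -- outputs 0 with probability at least 0.9 where f is 0 and at most 0.2 where f is 1, which gives
  -- the gap 0.7.
  have hexp : Real.exp (-t ^ 2) ≤ 0.1 := by
    have h1 : (20 : ℝ) ≤ t ^ 2 := le_trans (by exact_mod_cast hN) ht
    have h2 := Real.add_one_le_exp (t ^ 2)
    rw [Real.exp_neg]
    have h3 : (Real.exp (t ^ 2))⁻¹ ≤ (10 : ℝ)⁻¹ := inv_anti₀ (by norm_num) (by linarith)
    norm_num at h3 ⊢
    exact h3
  have hval : ∀ (f : ({j : Fin N // j ≠ i} → Fin 2) → Fin 2) (x : Fin N → Fin 2), x i = 0 →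
      |((if (f fun j => x j) = 0 then 1 else Real.exp (-t ^ 2)) : ℝ) -
        ‖zeroProj (Sum.inr i) (twoApply (L f) (withAncilla _ (EuclideanSpace.single x 1)))‖ ^ 2|
        ≤ 0.1 := by
    intro f x hx
    rw [hL]
    refine h f (a f) (W f) (hW f) _ _ (by simp) ?_
    have hw : ∀ n : ℕ, ‖zeroProj i (flipUnitary i (if n = 0 then 0 else f)
        (EuclideanSpace.single x 1))‖ ^ 2 =
        if n = 0 then 1 else if (f fun j => x j) = 0 then 1 else 0 := by
      intro n
      by_cases hn : n = 0
      · rw [if_pos hn, if_pos hn, flipUnitary_zero, norm_zeroProj_single_sq, if_pos hx]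
      · rw [if_neg hn, if_neg hn, flipUnitary_single, norm_zeroProj_single_sq, flipPerm_apply,
          Function.update_self, hx, zero_add]
    simp only [hw]
    by_cases hf : (f fun j => x j) = 0
    · simp only [hf, if_true, ite_self]
      simpa using hasSum_poisson t 1
    · simp only [hf, if_false]
      convert hasSum_single 0 ?_ using 1
      · simp
      · intro n hn
        simp [hn]
  have hle := card_le_of_distinguished hR0 (Sum.inr i) L hlen fun f f' hne => ?_
  · have hB : Fintype.card (({j : Fin N // j ≠ i} → Fin 2) → Fin 2) = 2 ^ 2 ^ (N - 1) := by
      simp [Fintype.card_subtype_compl]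
    rw [hB] at hle
    simp only [Fintype.card_sum, Fintype.card_fin] at hle
    omega
  · obtain ⟨y, hy⟩ := Function.ne_iff.1 hne
    -- The distinguishing input is a point where f and f' differ, with the measured qubit set to 0.
    let x : Fin N → Fin 2 := fun j => if hj : j ≠ i then y ⟨j, hj⟩ else 0
    have hx : (fun j : {j : Fin N // j ≠ i} => x j) = y := by
      funext j
      simp [x, j.2]
    have hxi : x i = 0 := by simp [x]
    refine ⟨withAncilla _ (EuclideanSpace.single x 1), by simp [norm_withAncilla], ?_⟩
    have h1 := hval f x hxi
    have h2 := hval f' x hxi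
    rw [hx] at h1 h2
    rw [le_abs]
    by_cases hf : f y = 0
    · have hf' : f' y ≠ 0 := fun e => hy (hf.trans e.symm)
      rw [if_pos hf] at h1
      rw [if_neg hf'] at h2
      left
      have := abs_le.1 h1
      have := abs_le.1 h2
      norm_num at *
      linarith
    · have hf' : f' y = 0 := by
        have h3 : ∀ a b : Fin 2, a ≠ b → a ≠ 0 → b = 0 := by decide
        exact h3 _ _ hy hf
      rw [if_neg hf] at h1
      rw [if_pos hf'] at h2
      right
      have := abs_le.1 h1
      have := abs_le.1 h2
      norm_num at *
      linarith

end Hard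

/-! ### Comparison of N T² with the gate bound, up to logarithms. -/

section Bounds

theorem one_le_log_add_two {y : ℝ} (hy : 1 ≤ y) : 1 ≤ Real.log (y + 2) := by
  rw [Real.le_log_iff_exp_le (by linarith)]
  have := Real.exp_one_lt_d9
  linarith

theorem div_log_sq_le_self {y : ℝ} (hy : 1 ≤ y) : y / Real.log (y + 2) ^ 2 ≤ y :=
  div_le_self (by linarith) (one_le_pow₀ (one_le_log_add_two hy))

/-- If the logarithm is at least N/4, its square pays for two factors N: the one in N·2^N and the
one lost in 2^N/N. Otherwise y < e^{N/4} is so small that yN ≤ 2^N and no logarithm is needed. -/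
theorem div_log_sq_le {N : ℕ} (hN : 20 ≤ N) {y : ℝ} (hy : 1 ≤ y) (hyN : y ≤ N * 2 ^ N) :
    y / Real.log (y + 2) ^ 2 ≤ 2240 * ((2 ^ (N - 1) / (35 * N) : ℕ) : ℝ) := by
  have hN0 : (0 : ℝ) < N := by
    have : 0 < N := by omega
    exact_mod_cast this
  -- Without the floor the constant would be 70; doubling it absorbs the rounding.
  have hR : (2 : ℝ) ^ N ≤ 140 * N * ((2 ^ (N - 1) / (35 * N) : ℕ) : ℝ) := by
    have h1 := mul_sq_le_two_pow hN
    have h2 : 2 ^ N = 2 * 2 ^ (N - 1) := by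
      rw [← pow_succ']
      congr 1
      omega
    have h3 := Nat.lt_mul_div_succ (2 ^ (N - 1)) (show 0 < 35 * N by omega)
    set R := 2 ^ (N - 1) / (35 * N)
    have h4 : 2 ^ N ≤ 140 * N * R := by
      rw [h2]
      have h5 : 70 * N ≤ 2 ^ (N - 1) := by nlinarith
      nlinarith
    exact_mod_cast h4
  set R : ℝ := ((2 ^ (N - 1) / (35 * N) : ℕ) : ℝ)
  have hR0 : 0 ≤ R := Nat.cast_nonneg _
  have hlog := one_le_log_add_two hy
  by_cases h : (N : ℝ) / 4 ≤ Real.log (y + 2)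
  · rw [div_le_iff₀ (by positivity)]
    have h1 : ((N : ℝ) / 4) ^ 2 ≤ Real.log (y + 2) ^ 2 := by gcongr
    calc y ≤ N * 2 ^ N := hyN
      _ ≤ N * (140 * N * R) := by gcongr
      _ = 2240 * R * ((N : ℝ) / 4) ^ 2 := by ring
      _ ≤ 2240 * R * Real.log (y + 2) ^ 2 := by gcongr
  · refine (div_log_sq_le_self hy).trans ?_
    have h1 : y + 2 ≤ Real.exp (N / 4) := by
      rw [← Real.log_le_iff_le_exp (by linarith)]
      linarith
    have h2 : y ^ 2 ≤ 2 ^ N := by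
      calc y ^ 2 ≤ Real.exp (N / 4) ^ 2 := by gcongr; linarith
        _ = Real.exp (1 / 2) ^ N := by
          rw [← Real.exp_nat_mul, ← Real.exp_nat_mul]
          congr 1
          push_cast
          ring
        _ ≤ 2 ^ N := by
          gcongr
          have h3 : Real.exp (1 / 2) ^ 2 ≤ 2 ^ 2 := by
            rw [← Real.exp_nat_mul]
            have := Real.exp_one_lt_d9
            norm_num
            linarith
          exact (sq_le_sq₀ (Real.exp_pos _).le (by norm_num)).1 h3
    have h3 : (N : ℝ) ^ 2 ≤ 2 ^ N := by
      have h4 := mul_sq_le_two_pow hN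
      have h5 : 2 ^ (N - 1) ≤ 2 ^ N := Nat.pow_le_pow_right (by norm_num) (by omega)
      have h6 : N ^ 2 ≤ 2 ^ N := by nlinarith
      exact_mod_cast h6
    have h4 : y * N ≤ 2 ^ N := by
      refine (sq_le_sq₀ (by positivity) (by positivity)).1 ?_
      rw [mul_pow, sq (2 ^ N : ℝ)]
      gcongr
    have h5 : y * N ≤ 140 * R * N := by linarith
    have h6 := le_of_mul_le_mul_right h5 hN0
    linarith

end Bounds
end
theorem mainTheorem4 :
    ∃ c : ℝ, 0 < c ∧ ∃ k : ℕ,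
      ∀ (N T : ℕ) (hN : 1 ≤ N),
        Real.sqrt N ≤ (T : ℝ) → (T : ℝ) ≤ (2 : ℝ) ^ ((N : ℝ) / 2) →
        ∃ U : BosonQubit N ≃ₗᵢ[ℂ] BosonQubit N, NumberPreserving U ∧
          ∃ V : ℝ → (BosonQubit N ≃ₗᵢ[ℂ] BosonQubit N), IsTimeEvolution (hamiltonian U) V ∧
            ∀ (a : ℕ) (W : QCircuit (Fin a ⊕ Fin N)),
              (∀ φ : QReg (Fin N), ‖φ‖ = 1 →
                ‖inner ℂ (V T (fockState 0 φ)) (idTensor (zeroProj ⟨0, hN⟩) (V T (fockState 0 φ)))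
                  - inner ℂ (W.apply (withAncilla a φ))
                      (zeroProj (Sum.inr ⟨0, hN⟩) (W.apply (withAncilla a φ)))‖ ≤ 0.1) →
              c * (N * (T : ℝ) ^ 2 / Real.log (N * (T : ℝ) ^ 2 + 2) ^ k) ≤ W.twoQubitGates := by
  -- For N < 20 one has N T² ≤ 20·2^20 < 2^25, so a single gate meets the bound; for N ≥ 20 the
  -- constant 2240 of `div_log_sq_le` is also below 2^25.
  refine ⟨1 / 2 ^ 25, by positivity, 2, fun N T hN hT hT' => ?_⟩
  have hN1 : (1 : ℝ) ≤ N := by exact_mod_cast hN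
  have hTN : (N : ℝ) ≤ (T : ℝ) ^ 2 := (Real.sqrt_le_left (Nat.cast_nonneg T)).1 hT
  have hT2 : (T : ℝ) ^ 2 ≤ 2 ^ N := by
    calc (T : ℝ) ^ 2 ≤ ((2 : ℝ) ^ ((N : ℝ) / 2)) ^ 2 := by gcongr
      _ = 2 ^ N := by
        rw [← Real.rpow_natCast, ← Real.rpow_mul (by norm_num), ← Real.rpow_natCast]
        congr 1
        push_cast
        ring
  have hy : (1 : ℝ) ≤ N * (T : ℝ) ^ 2 := by nlinarith
  have hyN : N * (T : ℝ) ^ 2 ≤ N * 2 ^ N := by gcongr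
  by_cases hlarge : 20 ≤ N
  · obtain ⟨U, hU, V, hV, h⟩ := exists_timeEvolution_hard hlarge ⟨0, hN⟩ hTN
    refine ⟨U, hU, V, hV, fun a W hW => ?_⟩
    have h1 : ((2 ^ (N - 1) / (35 * N) : ℕ) : ℝ) ≤ W.twoQubitGates := by
      exact_mod_cast h a W hW
    have h2 := div_log_sq_le hlarge hy hyN
    have h3 : (0 : ℝ) ≤ W.twoQubitGates := Nat.cast_nonneg _
    linarith
  · have hT1 : (1 : ℝ) ≤ T := (Real.one_le_sqrt.2 hN1).trans hT
    obtain ⟨U, hU, V, hV, h⟩ := exists_timeEvolution_pos ⟨0, hN⟩ hT1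
    refine ⟨U, hU, V, hV, fun a W hW => ?_⟩
    have h1 : (1 : ℝ) ≤ W.twoQubitGates := by exact_mod_cast h a W hW
    have h2 : (N : ℝ) * 2 ^ N ≤ 20 * 2 ^ 20 := by
      gcongr
      · exact_mod_cast (not_le.1 hlarge).le
      · norm_num
      · omega
    have h3 := div_log_sq_le_self hy
    norm_num at h2 ⊢
    linarith
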